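/- Let $R$ be an associative ring with $1$. "Module" means unital right $R$-module. A module $M$ is flat if $M\otimes_R -$ preserves injectivity of homomorphisms of left $R$-modules, and Mittag-Leffler if the canonical map $M\otimes_R\prod_{i\in I}Q_i\to\prod_{i\in I}(M\otimes_R Q_i)$ is injective for every family $(Q_i)_{i\in I}$ of left $R$-modules. Let $\mathcal F$ be the class of all flat modules and $\mathcal D$ the class of all flat Mittag-Leffler modules. For a class $\mathcal C$ of modules put $${}^\perp\mathcal C=\{M : \mathrm{Ext}^1_R(M,C)=0 \text{ for all } C\in\mathcal C\},\qquad \mathcal C^\perp=\{N : \mathrm{Ext}^1_R(C,N)=0 \text{ for all } C\in\mathcal C\}.$$ A class $\mathcal A$ is closed under products if the direct product of every family (indexed by a set) of modules from $\mathcal A$ is in $\mathcal A$. A module $M$ is a transfinite extension of modules in $\mathcal A$ if there are an ordinal $\lambda$ and an increasing chain $(M_\alpha\mid\alpha\le\lambda)$ of submodules of $M$ with $M_0=0$, $M_\lambda=M$, $M_\alpha=\bigcup_{\beta<\alpha}M_\beta$ for every limit ordinal $\alpha\le\lambda$, and $M_{\alpha+1}/M_\alpha$ isomorphic to an element of $\mathcal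 A$ for every $\alpha<\lambda$; $\mathcal A$ is closed under transfinite extensions if it contains every transfinite extension of modules in $\mathcal A$. The ring $R$ is right perfect if $R/J$ is semisimple and $J$ is right T-nilpotent, where $J$ is the Jacobson radical; right T-nilpotent means that for every sequence $a_0,a_1,\dots$ in $J$ there is $n$ with $a_{n-1}\cdots a_1a_0=0$. (i) If $R$ is not right perfect and $\mathcal D$ is closed under products, then $\mathcal D$ is closed under transfinite extensions, but $\mathcal D$ is not of the form ${}^\perp\mathcal C$ for any class $\mathcal C$ of modules. Both hypotheses hold, for example, whenever $R$ is left Noetherian and not left Artinian. (ii) If $R$ is countable and $\mathcal D$ is closed under products, then ${}^\perp(\mathcal D^\perp)=\mathcal F$. Both hypotheses hold, for example, whenever $R$ is countable and left Noetherian; indeed $\mathcal D$ is closed under products for every left Noetherian ring $R$. -/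

import Mathlib

open CategoryTheory

universe u

section TensorProduct

open scoped TensorProduct

/-- The relations `(m r) ⊗ n = m ⊗ (r n)`. A right `R`-module is a module over `Rᵐᵒᵖ`,
and `m r` is written `MulOpposite.op r • m`. -/
def balancingRelations (R M N : Type*) [Ring R] [AddCommGroup M] [Module Rᵐᵒᵖ M]
    [AddCommGroup N] [Module R N] : AddSubgroup (M ⊗[ℤ] N) :=
  AddSubgroup.closure
    {t | ∃ (m : M) (r : R) (n : N), t = (MulOpposite.op r • m) ⊗ₜ[ℤ] n - m ⊗ₜ[ℤ] (r • n)}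

/-- The tensor product `M ⊗_R N` of a right `R`-module `M` and a left `R`-module `N` over a
possibly noncommutative ring `R`, as an abelian group. -/
abbrev BalancedTensor (R M N : Type*) [Ring R] [AddCommGroup M] [Module Rᵐᵒᵖ M]
    [AddCommGroup N] [Module R N] : Type _ :=
  (M ⊗[ℤ] N) ⧸ balancingRelations R M N

/-- The homomorphism `M ⊗_R f : M ⊗_R N → M ⊗_R N'` induced by a homomorphism `f : N → N'` of
left `R`-modules; it sends `m ⊗ n` to `m ⊗ f n`. -/
def BalancedTensor.map (R M : Type*) {N N' : Type*} [Ring R] [AddCommGroup M] [Module Rᵐᵒᵖ M]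
    [AddCommGroup N] [Module R N] [AddCommGroup N'] [Module R N'] (f : N →ₗ[R] N') :
    BalancedTensor R M N →+ BalancedTensor R M N' :=
  QuotientAddGroup.map _ _
    (LinearMap.lTensor M f.toAddMonoidHom.toIntLinearMap).toAddMonoidHom (by
      refine (AddSubgroup.closure_le _).2 ?_
      rintro _ ⟨m, r, n, rfl⟩
      refine AddSubgroup.subset_closure ⟨m, r, f n, ?_⟩
      rw [map_sub, ← f.map_smul]
      rfl)

/-- The canonical map `ρ : M ⊗_R ∏ Q_i → ∏ (M ⊗_R Q_i)`, `m ⊗ (q_i)_i ↦ (m ⊗ q_i)_i`. -/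
def BalancedTensor.toPi (R M : Type*) [Ring R] [AddCommGroup M] [Module Rᵐᵒᵖ M]
    {I : Type*} (Q : I → Type*) [∀ i, AddCommGroup (Q i)] [∀ i, Module R (Q i)] :
    BalancedTensor R M (∀ i, Q i) →+ ∀ i, BalancedTensor R M (Q i) :=
  AddMonoidHom.pi fun i =>
    BalancedTensor.map R M (LinearMap.proj i : (∀ i, Q i) →ₗ[R] Q i)

end TensorProduct

/-- Classes of right `R`-modules. -/
abbrev RightModuleClass (R : Type u) [Ring R] := ObjectProperty (ModuleCat.{u} Rᵐᵒᵖ)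

section Classes

variable (R : Type u) [Ring R]

/-- The class `F` of flat right `R`-modules: `M ⊗_R -` preserves injectivity. -/
def flatModules : RightModuleClass R := fun M =>
  ∀ (N N' : Type u) [AddCommGroup N] [Module R N] [AddCommGroup N'] [Module R N']
    (f : N →ₗ[R] N'), Function.Injective f → Function.Injective (BalancedTensor.map R M f)

/-- The class of Mittag-Leffler right `R`-modules. -/
def mittagLefflerModules : RightModuleClass R := fun M =>
  ∀ (I : Type u) (Q : I → Type u) [∀ i, AddCommGroup (Q i)] [∀ i, Module R (Q i)],
    Function.Injective (BalancedTensor.toPi R M Q)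

/-- The class `D` of flat Mittag-Leffler right `R`-modules. -/
def flatMittagLefflerModules : RightModuleClass R := fun M =>
  flatModules R M ∧ mittagLefflerModules R M

variable {R}

/-- `⊥C`: the modules `M` with `Ext¹(M, N) = 0` for all `N` in `C`. -/
def leftExtOrthogonal (C : RightModuleClass R) : RightModuleClass R := fun M =>
  ∀ N : ModuleCat.{u} Rᵐᵒᵖ, C N → Subsingleton (Abelian.Ext M N 1)

/-- `C⊥`: the modules `N` with `Ext¹(M, N) = 0` for all `M` in `C`. -/
def rightExtOrthogonal (C : RightModuleClass R) : RightModuleClass R := fun N =>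
  ∀ M : ModuleCat.{u} Rᵐᵒᵖ, C M → Subsingleton (Abelian.Ext M N 1)

/-- Closure under direct products of arbitrary families. -/
def ClosedUnderProducts (A : RightModuleClass R) : Prop :=
  ∀ (I : Type u) (M : I → ModuleCat.{u} Rᵐᵒᵖ), (∀ i, A (M i)) →
    A (ModuleCat.of Rᵐᵒᵖ (∀ i, M i))

/-- A filtration `(F α ∣ α ≤ l)` of the module `M`: an increasing continuous chain of submodules
from `0` to `M`. The values of `F` at ordinals above `l` are irrelevant. -/
structure IsContinuousFiltration (M : ModuleCat.{u} Rᵐᵒᵖ) (l : Ordinal.{u})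
    (F : Ordinal.{u} → Submodule Rᵐᵒᵖ M) : Prop where
  mono : ∀ α β, α ≤ β → β ≤ l → F α ≤ F β
  zero : F 0 = ⊥
  last : F l = ⊤
  limit : ∀ α, α ≤ l → Order.IsSuccLimit α → (F α : Set M) = ⋃ β ∈ Set.Iio α, (F β : Set M)

/-- `M` is a transfinite extension of modules in `A`: it has a filtration each of whose
consecutive factors `F (α + 1) / F α` is isomorphic to an element of `A`. -/
def IsTransfiniteExtension (A : RightModuleClass R) (M : ModuleCat.{u} Rᵐᵒᵖ) : Prop :=
  ∃ (l : Ordinal.{u}) (F : Ordinal.{u} → Submodule Rᵐᵒᵖ M), IsContinuousFiltration M l F ∧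
    ∀ α, α < l → ∃ X : ModuleCat.{u} Rᵐᵒᵖ, A X ∧
      Nonempty ((F (α + 1) ⧸ (F α).submoduleOf (F (α + 1))) ≃ₗ[Rᵐᵒᵖ] X)

/-- Closure under transfinite extensions. -/
def ClosedUnderTransfiniteExtensions (A : RightModuleClass R) : Prop :=
  ∀ M : ModuleCat.{u} Rᵐᵒᵖ, IsTransfiniteExtension A M → A M

end Classes

/-- The product `a (n - 1) * ⋯ * a 1 * a 0`, in this order. -/
def descendingProd {R : Type*} [Ring R] (a : ℕ → R) : ℕ → R
  | 0 => 1
  | n + 1 => a n * descendingProd a n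

/-- `R` is right perfect: its Jacobson radical `J` is right T-nilpotent and `R / J` is
semisimple. -/
structure IsRightPerfect (R : Type*) [Ring R] : Prop where
  isSemisimpleRing : IsSemisimpleRing (R ⧸ Ring.jacobson R)
  rightTNilpotent : ∀ a : ℕ → R, (∀ n, a n ∈ Ring.jacobson R) → ∃ n, descendingProd a n = 0

/-! The proof works with one reformulation of the class D, `IsFlatML`: tensoring with M keeps every
jointly injective family of maps out of a common module jointly injective. Since a flat quotient
makes an extension pure, this property passes to extensions and to directed unions of pure
submodules, and transfinite induction gives closure under transfinite extensions.

The heart is `exists_extension_chainMap`: if L is the direct limit of a sequence E → E → ⋯ with E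
free, then Ext¹(L, C) = 0 for all C in D^⊥. The tree module on the finite sequences in κ is flat
Mittag-Leffler (`TreeModule.isFlatML`), and modulo the free module on its nodes it is a direct sum
of copies of L, one per branch ℕ → κ. If some map to C did not extend, distinct sets of branches
would yield distinct functions from the nodes to Hom(E, C). Choosing κ ≥ |Hom(E, C)| with 2^κ ≤ κ^ω,
this gives 2^(κ^ω) ≤ 2^κ ≤ κ^ω, against Cantor.

For (i): if D were some ⊥C, then D = ⊥(D^⊥) would contain every direct limit of R → R → ⋯ along
multiplications by a₀, a₁, …. The Mittag-Leffler property of that limit makes the chain R a₀ ⊇ R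
a₁a₀ ⊇ ⋯ stabilize (`BassModule.stabilizes`), and Bass's theorem (`isRightPerfect_of_chains`) makes
R right perfect.

For (ii): character modules lie in D^⊥, which forces the modules of ⊥(D^⊥) to be flat. Conversely,
over a countable ring a countable flat module is a sequential limit as above
(`exists_exact_chainMap`), and an arbitrary flat module is reached through countable pure steps and
Zorn's lemma.

Over a left Noetherian ring finitely generated left modules are finitely presented, so tensoring
with them commutes with products; this gives closure of D under products. If the ring is also right
perfect, stabilization of the annihilators of the powers of J makes J nilpotent, hence the ring left
Artinian. -/

namespace BalancedTensor

open scoped TensorProduct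

/-! ### Tensor products over a noncommutative ring: functoriality and right exactness. -/

section Basic

variable {R M M' M'' N N' N'' : Type*} [Ring R]
  [AddCommGroup M] [Module Rᵐᵒᵖ M] [AddCommGroup M'] [Module Rᵐᵒᵖ M']
  [AddCommGroup M''] [Module Rᵐᵒᵖ M'']
  [AddCommGroup N] [Module R N] [AddCommGroup N'] [Module R N'] [AddCommGroup N''] [Module R N'']

/-- The pure tensor `m ⊗ n`. -/
def tmul (R : Type*) {M N : Type*} [Ring R] [AddCommGroup M] [Module Rᵐᵒᵖ M]
    [AddCommGroup N] [Module R N] (m : M) (n : N) : BalancedTensor R M N :=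
  QuotientAddGroup.mk (m ⊗ₜ[ℤ] n)

theorem add_tmul (m m' : M) (n : N) : tmul R (m + m') n = tmul R m n + tmul R m' n := by
  simp [tmul, TensorProduct.add_tmul]

theorem tmul_add (m : M) (n n' : N) : tmul R m (n + n') = tmul R m n + tmul R m n' := by
  simp [tmul, TensorProduct.tmul_add]

theorem smul_tmul (m : M) (r : R) (n : N) :
    tmul R (MulOpposite.op r • m) n = tmul R m (r • n) :=
  (QuotientAddGroup.eq_iff_sub_mem).2 (AddSubgroup.subset_closure ⟨m, r, n, rfl⟩)

@[simp] theorem zero_tmul (n : N) : tmul R (0 : M) n = 0 := by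
  simp [tmul]

@[simp] theorem tmul_zero (m : M) : tmul R m (0 : N) = 0 := by
  simp [tmul]

theorem neg_tmul (m : M) (n : N) : tmul R (-m) n = -tmul R m n := by
  simp [tmul, TensorProduct.neg_tmul]

theorem tmul_neg (m : M) (n : N) : tmul R m (-n) = -tmul R m n := by
  simp [tmul, TensorProduct.tmul_neg]

theorem sum_tmul {ι : Type*} (s : Finset ι) (m : ι → M) (n : N) :
    tmul R (∑ i ∈ s, m i) n = ∑ i ∈ s, tmul R (m i) n := by
  classical
  induction s using Finset.induction_on with
  | empty => simp
  | insert a s ha ih => simp [ha, add_tmul, ih]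

theorem tmul_sum {ι : Type*} (s : Finset ι) (m : M) (n : ι → N) :
    tmul R m (∑ i ∈ s, n i) = ∑ i ∈ s, tmul R m (n i) := by
  classical
  induction s using Finset.induction_on with
  | empty => simp
  | insert a s ha ih => simp [ha, tmul_add, ih]

@[elab_as_elim]
theorem induction_on {p : BalancedTensor R M N → Prop} (z : BalancedTensor R M N)
    (zero : p 0) (tmul : ∀ m n, p (tmul R m n)) (add : ∀ x y, p x → p y → p (x + y)) : p z := by
  obtain ⟨t, rfl⟩ := QuotientAddGroup.mk_surjective z
  induction t using TensorProduct.induction_on with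
  | zero => exact zero
  | tmul m n => exact tmul m n
  | add x y hx hy => exact add _ _ hx hy

/-- Additive maps out of `M ⊗_R N` from balanced biadditive maps. -/
def lift {A : Type*} [AddCommGroup A] (φ : M →+ N →+ A)
    (h : ∀ m (r : R) n, φ (MulOpposite.op r • m) n = φ m (r • n)) : BalancedTensor R M N →+ A :=
  QuotientAddGroup.lift _ (TensorProduct.liftAddHom φ fun r m n => by simp) (by
    refine (AddSubgroup.closure_le _).2 ?_
    rintro _ ⟨m, r, n, rfl⟩
    simp [h, AddMonoidHom.mem_ker])

theorem hom_ext {A : Type*} [AddCommGroup A] {f g : BalancedTensor R M N →+ A}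
    (h : ∀ m n, f (tmul R m n) = g (tmul R m n)) : f = g := by
  refine DFunLike.ext _ _ fun z => ?_
  induction z using induction_on with
  | zero => simp
  | tmul m n => exact h m n
  | add x y hx hy => simp [hx, hy]

@[simp] theorem map_tmul (f : N →ₗ[R] N') (m : M) (n : N) :
    map R M f (tmul R m n) = tmul R m (f n) := rfl

/-- The homomorphism `g ⊗_R N` induced by a homomorphism `g` of right modules. -/
def mapLeft (N : Type*) [AddCommGroup N] [Module R N] (g : M →ₗ[Rᵐᵒᵖ] M') :
    BalancedTensor R M N →+ BalancedTensor R M' N :=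
  lift (AddMonoidHom.mk' (fun m => AddMonoidHom.mk' (fun n => tmul R (g m) n) fun _ _ => tmul_add _ _ _)
    fun m m' => by ext n; simp [add_tmul]) fun m r n => by simp [smul_tmul]

@[simp] theorem mapLeft_tmul (g : M →ₗ[Rᵐᵒᵖ] M') (m : M) (n : N) :
    mapLeft N g (tmul R m n) = tmul R (g m) n := rfl

theorem mapLeft_map (g : M →ₗ[Rᵐᵒᵖ] M') (f : N →ₗ[R] N') (z : BalancedTensor R M N) :
    mapLeft N' g (map R M f z) = map R M' f (mapLeft N g z) :=
  DFunLike.congr_fun (hom_ext (f := (mapLeft N' g).comp (map R M f))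
    (g := (map R M' f).comp (mapLeft N g)) fun _ _ => rfl) z

theorem map_map (f : N →ₗ[R] N') (g : N' →ₗ[R] N'') (z : BalancedTensor R M N) :
    map R M g (map R M f z) = map R M (g ∘ₗ f) z :=
  DFunLike.congr_fun (hom_ext (f := (map R M g).comp (map R M f))
    (g := map R M (g ∘ₗ f)) fun _ _ => rfl) z

theorem mapLeft_mapLeft (f : M →ₗ[Rᵐᵒᵖ] M') (g : M' →ₗ[Rᵐᵒᵖ] M'') (z : BalancedTensor R M N) :
    mapLeft N g (mapLeft N f z) = mapLeft N (g ∘ₗ f) z :=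
  DFunLike.congr_fun (hom_ext (f := (mapLeft N g).comp (mapLeft N f))
    (g := mapLeft N (g ∘ₗ f)) fun _ _ => rfl) z

theorem mapLeft_id (z : BalancedTensor R M N) : mapLeft N LinearMap.id z = z :=
  DFunLike.congr_fun (hom_ext (f := mapLeft N (LinearMap.id : M →ₗ[Rᵐᵒᵖ] M))
    (g := AddMonoidHom.id _) fun _ _ => rfl) z

theorem map_zero_hom (z : BalancedTensor R M N) : map R M (0 : N →ₗ[R] N') z = 0 :=
  DFunLike.congr_fun (hom_ext (f := map R M (0 : N →ₗ[R] N')) (g := 0) fun _ _ => by simp) z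

theorem mapLeft_zero_hom (z : BalancedTensor R M N) :
    mapLeft N (0 : M →ₗ[Rᵐᵒᵖ] M') z = 0 :=
  DFunLike.congr_fun (hom_ext (f := mapLeft N (0 : M →ₗ[Rᵐᵒᵖ] M')) (g := 0) fun _ _ => by simp) z

theorem toPi_apply {I : Type*} {Q : I → Type*} [∀ i, AddCommGroup (Q i)] [∀ i, Module R (Q i)]
    (z : BalancedTensor R M (∀ i, Q i)) (i : I) :
    toPi R M Q z i = map R M (LinearMap.proj i) z := rfl

theorem map_surjective {p : N →ₗ[R] N'} (hp : Function.Surjective p) :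
    Function.Surjective (map R M p) := by
  intro z
  induction z using induction_on with
  | zero => exact ⟨0, map_zero _⟩
  | tmul m n =>
    obtain ⟨n, rfl⟩ := hp n
    exact ⟨tmul R m n, rfl⟩
  | add x y hx hy =>
    obtain ⟨x, rfl⟩ := hx
    obtain ⟨y, rfl⟩ := hy
    exact ⟨x + y, map_add _ _ _⟩

theorem mapLeft_surjective {p : M →ₗ[Rᵐᵒᵖ] M'} (hp : Function.Surjective p) :
    Function.Surjective (mapLeft N p) := by
  intro z
  induction z using induction_on with
  | zero => exact ⟨0, map_zero _⟩
  | tmul m n =>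
    obtain ⟨m, rfl⟩ := hp m
    exact ⟨tmul R m n, rfl⟩
  | add x y hx hy =>
    obtain ⟨x, rfl⟩ := hx
    obtain ⟨y, rfl⟩ := hy
    exact ⟨x + y, map_add _ _ _⟩

/-- Right exactness of `M ⊗_R -`. -/
theorem exists_map_eq {f : N →ₗ[R] N'} {p : N' →ₗ[R] N''} (hp : Function.Surjective p)
    (hfp : ∀ n, p n = 0 → ∃ k, f k = n) {z : BalancedTensor R M N'} (hz : map R M p z = 0) :
    ∃ w, map R M f w = z := by
  obtain ⟨s, hs⟩ := hp.hasRightInverse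
  let Z := BalancedTensor R M N' ⧸ (map R M f).range
  have key : ∀ (m : M) (n n' : N'), p n = p n' →
      (QuotientAddGroup.mk (tmul R m n) : Z) = QuotientAddGroup.mk (tmul R m n') := by
    intro m n n' h
    obtain ⟨k, hk⟩ := hfp (-n + n') (by simp [h])
    refine QuotientAddGroup.eq.2 ⟨tmul R m k, ?_⟩
    rw [map_tmul, hk, tmul_add, tmul_neg]
  let ψ : BalancedTensor R M N'' →+ Z :=
    lift (AddMonoidHom.mk' (fun m => AddMonoidHom.mk'
        (fun n => (QuotientAddGroup.mk (tmul R m (s n)) : Z)) fun n n' => by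
          rw [← QuotientAddGroup.mk_add, ← tmul_add]
          exact key _ _ _ (by simp [hs _]))
      fun m m' => by
        ext n
        simp [add_tmul]) fun m r n => by
      simp only [AddMonoidHom.mk'_apply, smul_tmul]
      exact key _ _ _ (by simp [hs _])
  have hψ : ψ.comp (map R M p) = QuotientAddGroup.mk' _ :=
    hom_ext fun m n => key _ _ _ (by simp [hs _])
  have h := DFunLike.congr_fun hψ z
  rw [AddMonoidHom.comp_apply, hz, map_zero] at h
  exact (QuotientAddGroup.eq_zero_iff z).1 h.symm

/-- Right exactness of `- ⊗_R N`. -/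
theorem exists_mapLeft_eq {f : M →ₗ[Rᵐᵒᵖ] M'} {p : M' →ₗ[Rᵐᵒᵖ] M''} (hp : Function.Surjective p)
    (hfp : ∀ n, p n = 0 → ∃ k, f k = n) {z : BalancedTensor R M' N} (hz : mapLeft N p z = 0) :
    ∃ w, mapLeft N f w = z := by
  obtain ⟨s, hs⟩ := hp.hasRightInverse
  let Z := BalancedTensor R M' N ⧸ (mapLeft (R := R) N f).range
  have key : ∀ (m m' : M') (n : N), p m = p m' →
      (QuotientAddGroup.mk (tmul R m n) : Z) = QuotientAddGroup.mk (tmul R m' n) := by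
    intro m m' n h
    obtain ⟨k, hk⟩ := hfp (-m + m') (by simp [h])
    refine QuotientAddGroup.eq.2 ⟨tmul R k n, ?_⟩
    rw [mapLeft_tmul, hk, add_tmul, neg_tmul]
  let ψ : BalancedTensor R M'' N →+ Z :=
    lift (AddMonoidHom.mk' (fun m => AddMonoidHom.mk'
        (fun n => (QuotientAddGroup.mk (tmul R (s m) n) : Z)) fun n n' => by
          rw [← QuotientAddGroup.mk_add, ← tmul_add])
      fun m m' => by
        ext n
        simp only [AddMonoidHom.mk'_apply, AddMonoidHom.add_apply]
        rw [← QuotientAddGroup.mk_add, ← add_tmul]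
        exact key _ _ _ (by simp [hs _])) fun m r n => by
      simp only [AddMonoidHom.mk'_apply, ← smul_tmul]
      exact key _ _ _ (by simp [hs _])
  have hψ : ψ.comp (mapLeft N p) = QuotientAddGroup.mk' _ :=
    hom_ext fun m n => key _ _ _ (by simp [hs _])
  have h := DFunLike.congr_fun hψ z
  rw [AddMonoidHom.comp_apply, hz, map_zero] at h
  exact (QuotientAddGroup.eq_zero_iff z).1 h.symm

end Basic

/-! ### Coordinates of tensors with a free factor. -/

section Free

variable {R M M' Y Q Q' : Type*} [Ring R]
  [AddCommGroup M] [Module Rᵐᵒᵖ M] [AddCommGroup M'] [Module Rᵐᵒᵖ M']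
  [AddCommGroup Q] [Module R Q] [AddCommGroup Q'] [Module R Q']

/-- The coordinates of a tensor in `M ⊗_R R^(Y)`. -/
noncomputable def coordRight (R M Y : Type*) [Ring R] [AddCommGroup M] [Module Rᵐᵒᵖ M] :
    BalancedTensor R M (Y →₀ R) →+ (Y →₀ M) :=
  lift (AddMonoidHom.mk' (fun m => Finsupp.mapRange.addMonoidHom
      (AddMonoidHom.mk' (fun r : R => MulOpposite.op r • m) fun r r' => by simp [add_smul]))
    fun m m' => by ext; simp) fun m r n => by ext; simp [mul_smul]

@[simp] theorem coordRight_tmul (m : M) (k : Y →₀ R) (y : Y) :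
    coordRight R M Y (tmul R m k) y = MulOpposite.op (k y) • m := rfl

theorem sum_tmul_coordRight (z : BalancedTensor R M (Y →₀ R)) :
    (coordRight R M Y z).sum (fun y m => tmul R m (Finsupp.single y 1)) = z := by
  induction z using induction_on with
  | zero => simp
  | tmul m k =>
    rw [Finsupp.sum_of_support_subset (s := k.support)]
    · conv_rhs => rw [← Finsupp.sum_single k, Finsupp.sum, tmul_sum]
      refine Finset.sum_congr rfl fun y _ => ?_
      rw [coordRight_tmul, smul_tmul, Finsupp.smul_single, smul_eq_mul, mul_one]
    · intro y hy
      contrapose! hy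
      simpa using by simp [Finsupp.notMem_support_iff.1 hy]
    · simp
  | add x y hx hy =>
    rw [map_add, Finsupp.sum_add_index' (by simp) (by simp [add_tmul]), hx, hy]

theorem coordRight_injective : Function.Injective (coordRight R M Y) := fun z z' h => by
  rw [← sum_tmul_coordRight z, h, sum_tmul_coordRight]

theorem coordRight_mapLeft (g : M →ₗ[Rᵐᵒᵖ] M') (z : BalancedTensor R M (Y →₀ R)) (y : Y) :
    coordRight R M' Y (mapLeft _ g z) y = g (coordRight R M Y z y) := by
  induction z using induction_on with
  | zero => simp
  | tmul m k => simp
  | add x y hx hy => simp [hx, hy]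

theorem mapLeft_injective_of_free {g : M →ₗ[Rᵐᵒᵖ] M'} (hg : Function.Injective g) :
    Function.Injective (mapLeft (R := R) (Y →₀ R) g) := fun z z' h => by
  refine coordRight_injective (Finsupp.ext fun y => hg ?_)
  rw [← coordRight_mapLeft, ← coordRight_mapLeft, h]

/-- The coordinates of a tensor in `R^(Y) ⊗_R Q`. -/
noncomputable def coordLeft (R Y Q : Type*) [Ring R] [AddCommGroup Q] [Module R Q] :
    BalancedTensor R (Y →₀ Rᵐᵒᵖ) Q →+ (Y →₀ Q) :=
  lift (AddMonoidHom.mk' (fun k => AddMonoidHom.mk' (fun q : Q => Finsupp.mapRange.addMonoidHom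
      (AddMonoidHom.mk' (fun r : Rᵐᵒᵖ => r.unop • q) fun r r' => by simp [add_smul]) k)
      fun q q' => by ext; simp)
    fun m m' => by ext; simp [add_smul]) fun m r n => by ext; simp [mul_smul]

@[simp] theorem coordLeft_tmul (k : Y →₀ Rᵐᵒᵖ) (q : Q) (y : Y) :
    coordLeft R Y Q (tmul R k q) y = (k y).unop • q := rfl

theorem sum_tmul_coordLeft (z : BalancedTensor R (Y →₀ Rᵐᵒᵖ) Q) :
    (coordLeft R Y Q z).sum (fun y q => tmul R (Finsupp.single y (1 : Rᵐᵒᵖ)) q) = z := by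
  induction z using induction_on with
  | zero => simp
  | tmul k q =>
    rw [Finsupp.sum_of_support_subset (s := k.support)]
    · conv_rhs => rw [← Finsupp.sum_single k, Finsupp.sum, sum_tmul]
      refine Finset.sum_congr rfl fun y _ => ?_
      rw [coordLeft_tmul, ← smul_tmul, Finsupp.smul_single, MulOpposite.op_unop, smul_eq_mul,
        mul_one]
    · intro y hy
      contrapose! hy
      simpa using by simp [Finsupp.notMem_support_iff.1 hy]
    · simp
  | add x y hx hy =>
    rw [map_add, Finsupp.sum_add_index' (by simp) (by simp [tmul_add]), hx, hy]

theorem coordLeft_injective : Function.Injective (coordLeft R Y Q) := fun z z' h => by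
  rw [← sum_tmul_coordLeft z, h, sum_tmul_coordLeft]

theorem coordLeft_map (g : Q →ₗ[R] Q') (z : BalancedTensor R (Y →₀ Rᵐᵒᵖ) Q) (y : Y) :
    coordLeft R Y Q' (map R _ g z) y = g (coordLeft R Y Q z y) := by
  induction z using induction_on with
  | zero => simp
  | tmul m k => simp
  | add x y hx hy => simp [hx, hy]

end Free

/-- A tensor is a finite sum of pure tensors. -/
theorem exists_eq_sum {R M N : Type*} [Ring R] [AddCommGroup M] [Module Rᵐᵒᵖ M]
    [AddCommGroup N] [Module R N] (z : BalancedTensor R M N) :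
    ∃ (n : ℕ) (x : Fin n → M) (y : Fin n → N), z = ∑ i, tmul R (x i) (y i) := by
  induction z using induction_on with
  | zero => exact ⟨0, Fin.elim0, Fin.elim0, by simp⟩
  | tmul m n => exact ⟨1, fun _ => m, fun _ => n, by simp⟩
  | add a b ha hb =>
    obtain ⟨n, x, y, rfl⟩ := ha
    obtain ⟨n', x', y', rfl⟩ := hb
    exact ⟨n + n', Fin.append x x', Fin.append y y', by simp [Fin.sum_univ_add]⟩

end BalancedTensor

open BalancedTensor

/-! ### Flat Mittag-Leffler modules, purity and transfinite extensions. -/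

section Flat

variable (R : Type u) [Ring R]

/-- Flatness of an unbundled right module. -/
def IsFlat (M : Type u) [AddCommGroup M] [Module Rᵐᵒᵖ M] : Prop :=
  ∀ (N N' : Type u) [AddCommGroup N] [Module R N] [AddCommGroup N'] [Module R N']
    (f : N →ₗ[R] N'), Function.Injective f → Function.Injective (BalancedTensor.map R M f)

/-- The right module `M` is flat Mittag-Leffler if and only if `M ⊗_R -` preserves jointly
injective families. -/
def IsFlatML (M : Type u) [AddCommGroup M] [Module Rᵐᵒᵖ M] : Prop :=
  ∀ (N : Type u) [AddCommGroup N] [Module R N] (I : Type u) (Q : I → Type u)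
    [∀ i, AddCommGroup (Q i)] [∀ i, Module R (Q i)] (g : ∀ i, N →ₗ[R] Q i),
    (∀ n, (∀ i, g i n = 0) → n = 0) →
    ∀ z : BalancedTensor R M N, (∀ i, BalancedTensor.map R M (g i) z = 0) → z = 0

variable {R}

variable {M A B X : Type u} [AddCommGroup M] [Module Rᵐᵒᵖ M] [AddCommGroup A] [Module Rᵐᵒᵖ A]
  [AddCommGroup B] [Module Rᵐᵒᵖ B] [AddCommGroup X] [Module Rᵐᵒᵖ X]

theorem IsFlatML.isFlat (h : IsFlatML R M) : IsFlat R M := fun N N' _ _ _ _ f hf =>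
  (injective_iff_map_eq_zero _).2 fun z hz =>
    h N PUnit (fun _ => N') (fun _ => f) (fun _ hn => (map_eq_zero_iff f hf).1 (hn ⟨⟩)) z
      fun _ => hz

/-- A jointly injective family is an embedding into the product: flatness handles the embedding and
the Mittag-Leffler map separates the factors. Conversely, a single injection and the family of
projections of a product are both jointly injective. -/
theorem flatMittagLefflerModules_iff (M : ModuleCat.{u} Rᵐᵒᵖ) :
    flatMittagLefflerModules R M ↔ IsFlatML R M := by
  constructor
  · rintro ⟨h₁, h₂⟩ N _ _ I Q _ _ g hg z hz
    refine (map_eq_zero_iff _ (h₁ N (∀ i, Q i) (LinearMap.pi g) ?_)).1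
      ((map_eq_zero_iff _ (h₂ I Q)).1 ?_)
    · exact (injective_iff_map_eq_zero _).2 fun n hn => hg n fun i => congrFun hn i
    · funext i
      rw [toPi_apply, map_map]
      exact hz i
  · intro h
    refine ⟨h.isFlat, fun I Q _ _ => (injective_iff_map_eq_zero _).2 fun z hz => ?_⟩
    exact h _ I Q (fun i => LinearMap.proj i) (fun n hn => funext hn) z fun i => congrFun hz i

/-- An exact sequence of right modules `0 → A → B → X → 0` with `X` flat is pure. -/
theorem IsFlat.mapLeft_injective (hX : IsFlat R X) {i : A →ₗ[Rᵐᵒᵖ] B} {p : B →ₗ[Rᵐᵒᵖ] X}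
    (hi : Function.Injective i) (hp : Function.Surjective p) (hip : ∀ a, p (i a) = 0)
    (hpi : ∀ b, p b = 0 → ∃ a, i a = b) (Q : Type u) [AddCommGroup Q] [Module R Q] :
    Function.Injective (mapLeft (R := R) Q i) := by
  refine (injective_iff_map_eq_zero _).2 fun a ha => ?_
  -- A diagram chase over a free cover of Q: tensoring with the cover preserves injectivity of `i`,
  -- and flatness of X is needed only for the inclusion of the kernel of the cover.
  let π : (Q →₀ R) →ₗ[R] Q := Finsupp.linearCombination R id
  have hπ : Function.Surjective π := fun q => ⟨Finsupp.single q 1, by simp [π]⟩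
  have hπ' : ∀ n, π n = 0 → ∃ k, (LinearMap.ker π).subtype k = n := fun n hn => ⟨⟨n, hn⟩, rfl⟩
  obtain ⟨a', rfl⟩ := map_surjective (M := A) hπ a
  rw [mapLeft_map] at ha
  obtain ⟨b, hb⟩ := exists_map_eq (N := LinearMap.ker π) (f := (LinearMap.ker π).subtype) hπ hπ' ha
  have hb0 : mapLeft _ p b = 0 := by
    refine (injective_iff_map_eq_zero _).1 (hX _ _ _ (LinearMap.ker π).injective_subtype) _ ?_
    rw [← mapLeft_map, hb, mapLeft_mapLeft, show p ∘ₗ i = 0 from LinearMap.ext hip,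
      mapLeft_zero_hom]
  obtain ⟨c, rfl⟩ := exists_mapLeft_eq hp hpi hb0
  rw [← mapLeft_map] at hb
  rw [← mapLeft_injective_of_free hi hb, map_map,
    show π ∘ₗ (LinearMap.ker π).subtype = 0 from LinearMap.ext fun k => k.2, map_zero_hom]

/-- An extension of flat Mittag-Leffler modules is flat Mittag-Leffler. -/
theorem IsFlatML.extension (hA : IsFlatML R A) (hX : IsFlatML R X) {i : A →ₗ[Rᵐᵒᵖ] B}
    {p : B →ₗ[Rᵐᵒᵖ] X} (hi : Function.Injective i) (hp : Function.Surjective p)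
    (hip : ∀ a, p (i a) = 0) (hpi : ∀ b, p b = 0 → ∃ a, i a = b) : IsFlatML R B := by
  intro N _ _ I Q _ _ g hg z hz
  have hz0 : mapLeft _ p z = 0 := hX N I Q g hg _ fun j => by
    rw [← mapLeft_map, hz, map_zero]
  obtain ⟨a, rfl⟩ := exists_mapLeft_eq hp hpi hz0
  rw [hA N I Q g hg a fun j => ?_, map_zero]
  refine (injective_iff_map_eq_zero _).1
    (hX.isFlat.mapLeft_injective hi hp hip hpi (Q j)) _ ?_
  rw [mapLeft_map, hz]

/-- A module whose finite subsets are fixed by endomorphisms factoring through flat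
Mittag-Leffler modules is flat Mittag-Leffler. -/
theorem IsFlatML.of_locally_retract
    (h : ∀ (n : ℕ) (x : Fin n → M), ∃ (G : Type u) (_ : AddCommGroup G) (_ : Module Rᵐᵒᵖ G)
      (α : M →ₗ[Rᵐᵒᵖ] G) (β : G →ₗ[Rᵐᵒᵖ] M), IsFlatML R G ∧ ∀ k, β (α (x k)) = x k) :
    IsFlatML R M := by
  intro N _ _ I Q _ _ g hg z hz
  obtain ⟨n, x, y, rfl⟩ := exists_eq_sum z
  obtain ⟨G, _, _, α, β, hG, hx⟩ := h n x
  have h0 := hG N I Q g hg (mapLeft N α (∑ k, tmul R (x k) (y k))) fun i => by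
    rw [← mapLeft_map, hz, map_zero]
  have h1 := congrArg (mapLeft N β) h0
  simpa [hx] using h1

theorem IsFlatML.of_linearEquiv (e : A ≃ₗ[Rᵐᵒᵖ] B) (hB : IsFlatML R B) : IsFlatML R A :=
  IsFlatML.of_locally_retract fun _ x =>
    ⟨B, _, _, e.toLinearMap, e.symm.toLinearMap, hB, fun k => by simp⟩

theorem isFlatML_finsupp (Y : Type u) : IsFlatML R (Y →₀ Rᵐᵒᵖ) := by
  intro N _ _ I Q _ _ g hg z hz
  refine (injective_iff_map_eq_zero _).1 coordLeft_injective z (Finsupp.ext fun y => hg _ fun i => ?_)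
  rw [← coordLeft_map, hz]
  simp

theorem isFlatML_of_free [Module.Free Rᵐᵒᵖ M] : IsFlatML R M :=
  IsFlatML.of_linearEquiv (Module.Free.chooseBasis Rᵐᵒᵖ M).repr (isFlatML_finsupp _)

section Directed

variable {ι : Type*} {S : ι → Submodule Rᵐᵒᵖ M} {U : Submodule Rᵐᵒᵖ M}

theorem exists_mapLeft_subtype_eq (hS : Directed (· ≤ ·) S) (hU : ∀ i, S i ≤ U)
    (hM : ∀ x ∈ U, ∃ j, x ∈ S j)
    {N : Type*} [AddCommGroup N] [Module R N] (i : ι) (w : BalancedTensor R U N) :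
    ∃ j, S i ≤ S j ∧ ∃ w', mapLeft N (Submodule.inclusion (hU j)) w' = w := by
  induction w using BalancedTensor.induction_on with
  | zero => exact ⟨i, le_rfl, 0, map_zero _⟩
  | tmul m n =>
    obtain ⟨k, hk⟩ := hM m m.2
    obtain ⟨j, hij, hkj⟩ := hS i k
    exact ⟨j, hij, tmul R ⟨m, hkj hk⟩ n, rfl⟩
  | add x y hx hy =>
    obtain ⟨j, hj, x, rfl⟩ := hx
    obtain ⟨k, hk, y, rfl⟩ := hy
    obtain ⟨l, hjl, hkl⟩ := hS j k
    refine ⟨l, hj.trans hjl, mapLeft N (Submodule.inclusion hjl) x +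
      mapLeft N (Submodule.inclusion hkl) y, ?_⟩
    rw [map_add, mapLeft_mapLeft, mapLeft_mapLeft]
    rfl

/-- Tensor products commute with directed unions. -/
theorem exists_mapLeft_inclusion_eq_zero (hS : Directed (· ≤ ·) S) (hU : ∀ i, S i ≤ U)
    (hM : ∀ x ∈ U, ∃ j, x ∈ S j)
    {N : Type*} [AddCommGroup N] [Module R N] (i : ι) (z : BalancedTensor R (S i) N)
    (hz : mapLeft N (Submodule.inclusion (hU i)) z = 0) :
    ∃ j, ∃ h : S i ≤ S j, mapLeft N (Submodule.inclusion h) z = 0 := by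
  let π : (N →₀ R) →ₗ[R] N := Finsupp.linearCombination R id
  have hπ : Function.Surjective π := fun q => ⟨Finsupp.single q 1, by simp [π]⟩
  have hπ' : ∀ n, π n = 0 → ∃ k, (LinearMap.ker π).subtype k = n := fun n hn => ⟨⟨n, hn⟩, rfl⟩
  obtain ⟨z, rfl⟩ := map_surjective hπ z
  rw [mapLeft_map] at hz
  obtain ⟨w, hw⟩ := exists_map_eq (N := LinearMap.ker π) (f := (LinearMap.ker π).subtype) hπ hπ' hz
  obtain ⟨j, hj, w, rfl⟩ := exists_mapLeft_subtype_eq hS hU hM i w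
  refine ⟨j, hj, ?_⟩
  have : mapLeft _ (Submodule.inclusion hj) z = BalancedTensor.map R _ (LinearMap.ker π).subtype w := by
    refine mapLeft_injective_of_free (Submodule.inclusion_injective (hU j)) ?_
    rw [mapLeft_map, hw, mapLeft_mapLeft]
    rfl
  rw [mapLeft_map, this, map_map,
    show π ∘ₗ (LinearMap.ker π).subtype = 0 from LinearMap.ext fun k => k.2, map_zero_hom]

theorem mapLeft_inclusion_injective_of_directed (hS : Directed (· ≤ ·) S)
    (hU : ∀ i, S i ≤ U)
    (hM : ∀ x ∈ U, ∃ j, x ∈ S j) {N : Type*} [AddCommGroup N] [Module R N] (i : ι)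
    (hp : ∀ j (h : S i ≤ S j), Function.Injective (mapLeft (R := R) N (Submodule.inclusion h))) :
    Function.Injective (mapLeft (R := R) N (Submodule.inclusion (hU i))) := by
  refine (injective_iff_map_eq_zero _).2 fun z hz => ?_
  obtain ⟨j, h, hj⟩ := exists_mapLeft_inclusion_eq_zero hS hU hM i z hz
  exact (injective_iff_map_eq_zero _).1 (hp j h) z hj

/-- A directed union of pure flat Mittag-Leffler submodules is flat Mittag-Leffler. -/
theorem IsFlatML.of_directed [Nonempty ι] (hS : Directed (· ≤ ·) S) (hU : ∀ i, S i ≤ U)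
    (hM : ∀ x ∈ U, ∃ j, x ∈ S j)
    (hF : ∀ i, IsFlatML R (S i))
    (hp : ∀ i (N : Type u) [AddCommGroup N] [Module R N],
      Function.Injective (mapLeft (R := R) N (Submodule.inclusion (hU i)))) : IsFlatML R U := by
  intro N _ _ I Q _ _ g hg z hz
  obtain ⟨i⟩ := ‹Nonempty ι›
  obtain ⟨j, -, w, rfl⟩ := exists_mapLeft_subtype_eq hS hU hM i z
  rw [hF j N I Q g hg w fun k => ?_, map_zero]
  refine (injective_iff_map_eq_zero _).1 (hp j _) _ ?_
  rw [mapLeft_map, hz]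

end Directed

/-- Flat Mittag-Leffler modules are closed under transfinite extensions, over every ring. -/
theorem closedUnderTransfiniteExtensions_flatMittagLeffler :
    ClosedUnderTransfiniteExtensions (flatMittagLefflerModules R) := by
  rintro M ⟨l, F, hF, hA⟩
  rw [flatMittagLefflerModules_iff]
  -- Purity of all earlier terms is carried along, because the limit step needs the union to be one
  -- of pure submodules.
  have key : ∀ α, α ≤ l → IsFlatML R (F α) ∧ ∀ β, β ≤ α → ∀ (h : F β ≤ F α)
      (N : Type u) [AddCommGroup N] [Module R N],
      Function.Injective (mapLeft (R := R) N (Submodule.inclusion h)) := by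
    have hrefl : ∀ α (h : F α ≤ F α) (N : Type u) [AddCommGroup N] [Module R N],
        Function.Injective (mapLeft (R := R) N (Submodule.inclusion h)) := by
      intro α h N _ _
      rw [show Submodule.inclusion h = LinearMap.id from rfl]
      exact fun x y hxy => by rwa [mapLeft_id, mapLeft_id] at hxy
    intro α
    induction α using Ordinal.limitRecOn with
    | zero =>
      refine fun _ => ⟨IsFlatML.of_locally_retract fun n x => ⟨PUnit →₀ Rᵐᵒᵖ, _, _, 0, 0,
        isFlatML_finsupp _, fun k => ?_⟩, fun β hβ h => ?_⟩
      · have h0 : (x k : M) ∈ (⊥ : Submodule Rᵐᵒᵖ M) := hF.zero ▸ (x k).2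
        exact Subtype.ext ((Submodule.mem_bot _).1 h0).symm
      · obtain rfl : β = 0 := by simpa using hβ
        exact hrefl _ h
    | add_one α ih =>
      intro hα
      have hαl : α < l := (Order.lt_succ α).trans_le hα
      obtain ⟨ih₁, ih₂⟩ := ih hαl.le
      have hle : F α ≤ F (α + 1) := hF.mono _ _ (Order.le_succ α) hα
      obtain ⟨X, hX, ⟨e⟩⟩ := hA α hαl
      rw [flatMittagLefflerModules_iff] at hX
      let p : F (α + 1) →ₗ[Rᵐᵒᵖ] X := e.toLinearMap ∘ₗ ((F α).submoduleOf (F (α + 1))).mkQ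
      have hp : Function.Surjective p := e.surjective.comp (Submodule.mkQ_surjective _)
      have hp0 : ∀ b, p b = 0 ↔ (b : M) ∈ F α := fun b => by
        simp only [p, LinearMap.comp_apply, LinearEquiv.coe_coe, map_eq_zero_iff e e.injective,
          Submodule.mkQ_apply, Submodule.Quotient.mk_eq_zero]
        rfl
      have hi := Submodule.inclusion_injective hle
      have hip : ∀ a, p (Submodule.inclusion hle a) = 0 := fun a => (hp0 _).2 a.2
      have hpi : ∀ b, p b = 0 → ∃ a, Submodule.inclusion hle a = b := fun b hb =>
        ⟨⟨b, (hp0 b).1 hb⟩, rfl⟩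
      refine ⟨ih₁.extension hX hi hp hip hpi, fun β hβ h N _ _ => ?_⟩
      rcases hβ.lt_or_eq with hβ | rfl
      · have hβ' : β ≤ α := Order.lt_succ_iff.1 hβ
        have h₁ := ih₂ β hβ' (hF.mono _ _ hβ' hαl.le) N
        have h₂ := hX.isFlat.mapLeft_injective hi hp hip hpi N
        convert h₂.comp h₁ using 1
        funext z
        rw [Function.comp_apply, mapLeft_mapLeft]
        rfl
      · exact hrefl _ h N
    | limit α hα ih =>
      intro hαl
      have hle : ∀ β : Set.Iio α, F β.1 ≤ F α := fun β => hF.mono _ _ (le_of_lt β.2) hαl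
      have hS : Directed (· ≤ ·) fun β : Set.Iio α => F β.1 :=
        Monotone.directed_le fun β γ h => hF.mono _ _ h ((le_of_lt γ.2).trans hαl)
      have hM : ∀ x ∈ F α, ∃ β : Set.Iio α, x ∈ F β.1 := fun x hx => by
        rw [← SetLike.mem_coe, hF.limit α hαl hα] at hx
        simp only [Set.mem_iUnion] at hx
        obtain ⟨β, hβ, hx⟩ := hx
        exact ⟨⟨β, hβ⟩, hx⟩
      have hp : ∀ (β : Set.Iio α) (N : Type u) [AddCommGroup N] [Module R N],
          Function.Injective (mapLeft (R := R) N (Submodule.inclusion (hle β))) := by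
        intro β N _ _
        refine mapLeft_inclusion_injective_of_directed hS hle hM β fun γ h => ?_
        -- The inclusion `h` of submodules need not come from β ≤ γ; if γ ≤ β, the two submodules
        -- coincide.
        rcases le_total β.1 γ.1 with hβγ | hγβ
        · exact (ih γ.1 γ.2 ((le_of_lt γ.2).trans hαl)).2 β.1 hβγ h N
        · have heq : F β.1 = F γ.1 :=
            le_antisymm h (hF.mono _ _ hγβ ((le_of_lt β.2).trans hαl))
          have h' : F γ.1 ≤ F β.1 := heq.ge
          refine Function.LeftInverse.injective (g := mapLeft N (Submodule.inclusion h'))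
            fun z => ?_
          rw [mapLeft_mapLeft]
          exact mapLeft_id z
      have : Nonempty (Set.Iio α) := ⟨⟨0, hα.bot_lt⟩⟩
      refine ⟨IsFlatML.of_directed hS hle hM
        (fun β => (ih β.1 β.2 ((le_of_lt β.2).trans hαl)).1) hp, fun β hβ h N _ _ => ?_⟩
      rcases hβ.lt_or_eq with hβ | rfl
      · exact hp ⟨β, hβ⟩ N
      · exact hrefl _ h N
  exact IsFlatML.of_linearEquiv
    (Submodule.topEquiv.symm.trans (LinearEquiv.ofEq _ _ hF.last.symm)) (key l le_rfl).1

end Flat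

/-! ### Vanishing of Ext¹ as extension and lifting of homomorphisms. -/

section ExtInterface

variable {S : Type u} [Ring S]
variable {A P X C : Type u} [AddCommGroup A] [Module S A] [AddCommGroup P] [Module S P]
  [AddCommGroup X] [Module S X] [AddCommGroup C] [Module S C]

theorem ModuleCat.shortExact_of_linearMap {i : A →ₗ[S] P} {p : P →ₗ[S] X}
    (hi : Function.Injective i) (hp : Function.Surjective p) (hip : Function.Exact i p) :
    (ShortComplex.mk (ModuleCat.ofHom i) (ModuleCat.ofHom p)
      (by rw [← ModuleCat.ofHom_comp, hip.linearMap_comp_eq_zero]; rfl)).ShortExact where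
  exact := (ShortComplex.ShortExact.moduleCat_exact_iff_function_exact _).2 hip
  mono_f := (ModuleCat.mono_iff_injective _).2 hi
  epi_g := (ModuleCat.epi_iff_surjective _).2 hp

/-- If `Ext¹(X, C) = 0`, then homomorphisms to `C` extend along monomorphisms with cokernel `X`. -/
theorem exists_extension_of_subsingleton_ext {i : A →ₗ[S] P} {p : P →ₗ[S] X}
    (hi : Function.Injective i) (hp : Function.Surjective p) (hip : Function.Exact i p)
    (h : Subsingleton (Abelian.Ext (ModuleCat.of S X) (ModuleCat.of S C) 1)) (g : A →ₗ[S] C) :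
    ∃ g' : P →ₗ[S] C, g' ∘ₗ i = g := by
  have hS := ModuleCat.shortExact_of_linearMap hi hp hip
  obtain ⟨x, hx⟩ := Abelian.Ext.contravariant_sequence_exact₁ hS (ModuleCat.of S C)
    (Abelian.Ext.mk₀ (ModuleCat.ofHom g)) (n₁ := 1) rfl (Subsingleton.elim _ _)
  obtain ⟨f, rfl⟩ := (Abelian.Ext.mk₀_bijective _ _).2 x
  rw [Abelian.Ext.mk₀_comp_mk₀] at hx
  have := (Abelian.Ext.mk₀_bijective _ _).1 hx
  exact ⟨f.hom, by simpa using congrArg ModuleCat.Hom.hom this⟩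

/-- If `Ext¹(X, A) = 0`, then homomorphisms from `X` lift along epimorphisms with kernel `A`. -/
theorem exists_lift_of_subsingleton_ext {i : A →ₗ[S] P} {p : P →ₗ[S] C}
    (hi : Function.Injective i) (hp : Function.Surjective p) (hip : Function.Exact i p)
    (h : Subsingleton (Abelian.Ext (ModuleCat.of S X) (ModuleCat.of S A) 1)) (g : X →ₗ[S] C) :
    ∃ g' : X →ₗ[S] P, p ∘ₗ g' = g := by
  have hS := ModuleCat.shortExact_of_linearMap hi hp hip
  obtain ⟨x, hx⟩ := Abelian.Ext.covariant_sequence_exact₃ (ModuleCat.of S X) hS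
    (Abelian.Ext.mk₀ (ModuleCat.ofHom g)) (n₁ := 1) rfl (Subsingleton.elim _ _)
  obtain ⟨f, rfl⟩ := (Abelian.Ext.mk₀_bijective _ _).2 x
  rw [Abelian.Ext.mk₀_comp_mk₀] at hx
  have := (Abelian.Ext.mk₀_bijective _ _).1 hx
  exact ⟨f.hom, by simpa using congrArg ModuleCat.Hom.hom this⟩

/-- `Ext¹(X, C) = 0` if homomorphisms to `C` extend along a monomorphism to a projective module
with cokernel `X`. -/
theorem subsingleton_ext_of_exists_extension [Module.Projective S P] {i : A →ₗ[S] P}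
    {p : P →ₗ[S] X} (hi : Function.Injective i) (hp : Function.Surjective p)
    (hip : Function.Exact i p)
    (h : ∀ g : A →ₗ[S] C, ∃ g' : P →ₗ[S] C, g' ∘ₗ i = g) :
    Subsingleton (Abelian.Ext (ModuleCat.of S X) (ModuleCat.of S C) 1) := by
  have hS := ModuleCat.shortExact_of_linearMap hi hp hip
  have : Projective (ModuleCat.of S P) := (IsProjective.iff_projective P).1 inferInstance
  refine subsingleton_of_forall_eq 0 fun x => ?_
  obtain ⟨y, rfl⟩ := Abelian.Ext.contravariant_sequence_exact₃ hS (ModuleCat.of S C) x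
    (Abelian.Ext.eq_zero_of_projective _) (n₀ := 0) rfl
  obtain ⟨f, rfl⟩ := (Abelian.Ext.mk₀_bijective _ _).2 y
  obtain ⟨g, hg⟩ := h f.hom
  have : f = ModuleCat.ofHom i ≫ ModuleCat.ofHom g := by
    ext a
    exact (LinearMap.congr_fun hg a).symm
  rw [this, ← Abelian.Ext.mk₀_comp_mk₀, hS.extClass_comp_assoc]

end ExtInterface

/-! ### The telescope presentation of a sequential direct limit. -/

section ChainMap

variable {S : Type*} [Ring S] {E : Type*} [AddCommGroup E] [Module S E]

/-- The map `e_n x ↦ e_n x - e_{n+1} (f_n x)` of `E^(ℕ)`; its cokernel is the direct limit of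
`E → E → ⋯` along the maps `f_n`. -/
noncomputable def chainMap (f : ℕ → E →ₗ[S] E) : (ℕ →₀ E) →ₗ[S] (ℕ →₀ E) :=
  Finsupp.lsum ℕ fun n => Finsupp.lsingle n - Finsupp.lsingle (n + 1) ∘ₗ f n

theorem chainMap_single (f : ℕ → E →ₗ[S] E) (n : ℕ) (x : E) :
    chainMap f (Finsupp.single n x) = Finsupp.single n x - Finsupp.single (n + 1) (f n x) := by
  simp [chainMap]

theorem chainMap_apply_zero (f : ℕ → E →ₗ[S] E) (z : ℕ →₀ E) : chainMap f z 0 = z 0 := by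
  induction z using Finsupp.induction_linear with
  | zero => simp
  | add x y hx hy => simp [hx, hy]
  | single n x => simp [chainMap_single]

theorem chainMap_apply_succ (f : ℕ → E →ₗ[S] E) (z : ℕ →₀ E) (n : ℕ) :
    chainMap f z (n + 1) = z (n + 1) - f n (z n) := by
  induction z using Finsupp.induction_linear with
  | zero => simp
  | add x y hx hy => simp [hx, hy]; abel
  | single m x =>
    rw [chainMap_single, Finsupp.sub_apply]
    by_cases h : m = n
    · subst h; simp
    · simp [Finsupp.single_apply, h]

/-- The map is unitriangular: each coordinate of the argument is recovered from the image and the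
preceding coordinate. -/
theorem chainMap_injective (f : ℕ → E →ₗ[S] E) : Function.Injective (chainMap f) := by
  refine (injective_iff_map_eq_zero _).2 fun z hz => Finsupp.ext fun n => ?_
  induction n with
  | zero => rw [← chainMap_apply_zero f, hz]
  | succ n ih =>
    have := chainMap_apply_succ f z n
    rw [hz, ih] at this
    simpa using this.symm

end ChainMap

/-! ### The tree module. -/

namespace TreeModule

section Definitions

variable {S : Type*} [Ring S] {E : Type*} [AddCommGroup E] [Module S E] (κ : Type*)

/-- Finite sequences in `κ`, the nodes of the tree whose branches are the sequences `ℕ → κ`. -/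
abbrev Node : Type _ := Σ n : ℕ, Fin n → κ

variable {κ}

/-- The initial segment of length `n` of a branch. -/
def node (η : ℕ → κ) (n : ℕ) : Node κ := ⟨n, fun i => η i⟩

theorem node_eq_iff {η τ : ℕ → κ} {n : ℕ} : node η n = node τ n ↔ ∀ i < n, η i = τ i := by
  simp only [node, Sigma.mk.injEq, heq_eq_eq, true_and, funext_iff]
  exact ⟨fun h i hi => h ⟨i, hi⟩, fun h i => h i i.2⟩

theorem node_eq_of_le {η τ : ℕ → κ} {m n : ℕ} (h : m ≤ n) (hn : node η n = node τ n) :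
    node η m = node τ m :=
  node_eq_iff.2 fun i hi => node_eq_iff.1 hn i (hi.trans_le h)

theorem exists_node_ne {η τ : ℕ → κ} (h : η ≠ τ) : ∃ N, ∀ n ≥ N, node η n ≠ node τ n := by
  obtain ⟨i, hi⟩ := Function.ne_iff.1 h
  exact ⟨i + 1, fun n hn he => hi (node_eq_iff.1 he i hn)⟩

variable (S E κ) in
/-- The generators of the tree module: one copy of `E` for each node, and one copy of `E` for
each branch and each natural number. -/
abbrev Gen : Type _ := (Node κ →₀ E) × (((ℕ → κ) × ℕ) →₀ E)

variable (S) in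
/-- The copy of `E` at a node. -/
noncomputable def atNode (s : Node κ) : E →ₗ[S] Gen E κ :=
  LinearMap.inl S _ _ ∘ₗ Finsupp.lsingle s

variable (S) in
/-- The `n`-th copy of `E` on a branch. -/
noncomputable def atBranch (η : ℕ → κ) (n : ℕ) : E →ₗ[S] Gen E κ :=
  LinearMap.inr S _ _ ∘ₗ Finsupp.lsingle (η, n)

/-- The relations of the tree module. -/
noncomputable def relation (κ : Type*) (f : ℕ → E →ₗ[S] E) :
    (((ℕ → κ) × ℕ) →₀ E) →ₗ[S] Gen E κ :=
  Finsupp.lsum ℕ fun p =>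
    atBranch S p.1 p.2 - atBranch S p.1 (p.2 + 1) ∘ₗ f p.2 - atNode S (node p.1 p.2)

variable (f : ℕ → E →ₗ[S] E)

theorem relation_single (η : ℕ → κ) (n : ℕ) (x : E) :
    relation κ f (Finsupp.single (η, n) x) =
      atBranch S η n x - atBranch S η (n + 1) (f n x) - atNode S (node η n) x := by
  simp [relation]

theorem relation_snd_zero (z : ((ℕ → κ) × ℕ) →₀ E) (η : ℕ → κ) :
    (relation κ f z).2 (η, 0) = z (η, 0) := by
  induction z using Finsupp.induction_linear with
  | zero => simp
  | add x y hx hy => simp [hx, hy]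
  | single p x =>
    obtain ⟨τ, m⟩ := p
    simp [relation_single, atBranch, atNode]

theorem relation_snd_succ (z : ((ℕ → κ) × ℕ) →₀ E) (η : ℕ → κ) (n : ℕ) :
    (relation κ f z).2 (η, n + 1) = z (η, n + 1) - f n (z (η, n)) := by
  induction z using Finsupp.induction_linear with
  | zero => simp
  | add x y hx hy => simp [hx, hy]; abel
  | single p x =>
    obtain ⟨τ, m⟩ := p
    by_cases h : τ = η ∧ m = n
    · obtain ⟨rfl, rfl⟩ := h
      simp [relation_single, atBranch, atNode]
    · have h' : ¬ ((τ, m) = (η, n)) := fun h' => h (Prod.ext_iff.1 h')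
      have h'' : ¬ ((τ, m + 1) = (η, n + 1)) := fun h' => h (by simpa using h')
      simp [relation_single, atBranch, atNode, h', h'']

/-- Projected to the branch generators, the relations form one copy of `chainMap f` per branch, so
the same triangular induction applies. -/
theorem relation_injective : Function.Injective (relation κ f) := by
  refine (injective_iff_map_eq_zero _).2 fun z hz => Finsupp.ext fun p => ?_
  obtain ⟨η, n⟩ := p
  induction n with
  | zero => rw [← relation_snd_zero f, hz]; rfl
  | succ n ih =>
    have := relation_snd_succ f z η n
    rw [hz, ih] at this
    simpa using this.symm

/-- Two homomorphisms agreeing on the generators in the support of an element agree on it. -/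
theorem map_eq_of_support {L : Type*} [AddCommGroup L] [Module S L] {φ ψ : Gen E κ →ₗ[S] L}
    (p : Gen E κ) (h₁ : ∀ s ∈ p.1.support, ∀ x, φ (atNode S s x) = ψ (atNode S s x))
    (h₂ : ∀ i ∈ p.2.support, ∀ x, φ (atBranch S i.1 i.2 x) = ψ (atBranch S i.1 i.2 x)) :
    φ p = ψ p := by
  have hp : p = (∑ s ∈ p.1.support, atNode S s (p.1 s)) +
      ∑ i ∈ p.2.support, atBranch S i.1 i.2 (p.2 i) := by
    simp only [atNode, atBranch, LinearMap.comp_apply, ← map_sum, Finsupp.lsingle_apply]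
    have e₁ : ∑ s ∈ p.1.support, Finsupp.single s (p.1 s) = p.1 := Finsupp.sum_single p.1
    have e₂ : ∑ i ∈ p.2.support, Finsupp.single (i.1, i.2) (p.2 i) = p.2 :=
      Finsupp.sum_single p.2
    rw [e₁, e₂]
    simp
  rw [hp, map_add, map_add, map_sum, map_sum, map_sum, map_sum,
    Finset.sum_congr rfl fun s hs => h₁ s hs _, Finset.sum_congr rfl fun s hs => h₂ s hs _]

/-- The recursion computes stage n from stage n + 1, so values given far out on a branch propagate
down to all stages. -/
theorem exists_descending {P : Type*} [AddCommGroup P] [Module S P] (δ : ℕ → E →ₗ[S] P) (k : ℕ) :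
    ∀ b : ℕ → E →ₗ[S] P, (∀ n ≥ k, b n = b (n + 1) ∘ₗ f n + δ n) →
      ∃ a : ℕ → E →ₗ[S] P, (∀ n, a n = a (n + 1) ∘ₗ f n + δ n) ∧ ∀ n ≥ k, a n = b n := by
  induction k with
  | zero => exact fun b hb => ⟨b, fun n => hb n n.zero_le, fun _ _ => rfl⟩
  | succ k ih =>
    intro b hb
    obtain ⟨a, ha, hab⟩ := ih (Function.update b k (b (k + 1) ∘ₗ f k + δ k)) fun n hn => by
      rcases hn.eq_or_lt with rfl | hn
      · simp
      · rw [Function.update_of_ne (by lia), Function.update_of_ne (by lia)]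
        exact hb n hn
    exact ⟨a, ha, fun n hn => by rw [hab n (by lia), Function.update_of_ne (by lia)]⟩

open Classical in
/-- Finitely many elements of the tree module are fixed by an endomorphism that factors through
the module of generators. -/
theorem exists_approx (T : Finset (ℕ → κ)) (N : ℕ)
    (hN : ∀ η ∈ T, ∀ τ ∈ T, node η N = node τ N → η = τ) :
    ∃ α : Gen E κ →ₗ[S] Gen E κ, (∀ z, α (relation κ f z) = 0) ∧
      (∀ s : Node κ, s.1 < N → ∀ x, α (atNode S s x) = atNode S s x) ∧
      ∀ η ∈ T, ∀ n x, α (atBranch S η n x) - atBranch S η n x ∈ LinearMap.range (relation κ f) := by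
  -- A node at level at least `N` on a branch of `T` is replaced by what its relation says it
  -- equals; a high node off `T` goes to 0. By separation at level `N`, at most one branch of `T`
  -- passes through a high node, so the choice is forced.
  let αd : Node κ → E →ₗ[S] Gen E κ := fun s => if s.1 < N then atNode S s else
    if h : ∃ η ∈ T, node η s.1 = s then
      atBranch S h.choose s.1 - atBranch S h.choose (s.1 + 1) ∘ₗ f s.1 else 0
  have hd : ∀ s : Node κ, s.1 < N → αd s = atNode S s := fun s hs => if_pos hs
  have hdT : ∀ η ∈ T, ∀ n ≥ N, αd (node η n) = atBranch S η n - atBranch S η (n + 1) ∘ₗ f n := by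
    intro η hη n hn
    have h : ∃ τ ∈ T, node τ (node η n).1 = node η n := ⟨η, hη, rfl⟩
    have hτ : h.choose = η :=
      hN _ h.choose_spec.1 _ hη (node_eq_of_le hn h.choose_spec.2)
    simp only [αd]
    rw [if_neg (by simpa [node] using hn), dif_pos h, hτ]
    rfl
  have hy : ∀ η : ℕ → κ, ∃ a : ℕ → E →ₗ[S] Gen E κ,
      (∀ n, a n = a (n + 1) ∘ₗ f n + αd (node η n)) ∧
      (η ∈ T → ∀ n ≥ N, a n = atBranch S η n) := by
    intro η
    by_cases hη : η ∈ T
    · obtain ⟨a, ha, hab⟩ := exists_descending f (fun n => αd (node η n)) N (atBranch S η)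
        fun n hn => by rw [hdT η hη n hn]; abel
      exact ⟨a, ha, fun _ => hab⟩
    · have : ∃ k ≥ N, ∀ n ≥ k, ∀ τ ∈ T, node τ n ≠ node η n := by
        have : ∀ τ ∈ T, ∃ k, ∀ n ≥ k, node τ n ≠ node η n := fun τ hτ =>
          exists_node_ne (fun h => hη (h ▸ hτ))
        choose! k hk using this
        exact ⟨max N (T.sup k), le_max_left _ _, fun n hn τ hτ => hk τ hτ n
          ((Finset.le_sup hτ).trans ((le_max_right _ _).trans hn))⟩
      obtain ⟨k, hkN, hk⟩ := this
      obtain ⟨a, ha, -⟩ := exists_descending f (fun n => αd (node η n)) k 0 fun n hn => by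
        have h₁ : ¬ (node η n).1 < N := by simpa [node] using hkN.trans hn
        have h₂ : ¬ ∃ τ ∈ T, node τ (node η n).1 = node η n := by
          rintro ⟨τ, hτ, h⟩
          exact hk n hn τ hτ h
        simp only [αd]
        rw [if_neg h₁, dif_neg h₂]
        simp
      exact ⟨a, ha, fun h => absurd h hη⟩
  choose a ha haT using hy
  let α : Gen E κ →ₗ[S] Gen E κ :=
    LinearMap.coprod (Finsupp.lsum ℕ αd) (Finsupp.lsum ℕ fun p => a p.1 p.2)
  have hαd : ∀ s x, α (atNode S s x) = αd s x := fun s x => by simp [α, atNode]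
  have hαy : ∀ η n x, α (atBranch S η n x) = a η n x := fun η n x => by simp [α, atBranch]
  refine ⟨α, fun z => ?_, fun s hs x => by rw [hαd, hd s hs], fun η hη n x => ?_⟩
  · induction z using Finsupp.induction_linear with
    | zero => simp
    | add x y hx hy => simp [hx, hy]
    | single p x =>
      obtain ⟨η, n⟩ := p
      rw [relation_single, map_sub, map_sub, hαy, hαy, hαd, ha η n]
      simp
  · rw [hαy]
    by_cases hn : N ≤ n
    · rw [haT η hη n hn, sub_self]
      exact zero_mem _
    · induction hm : N - n generalizing n x with
      | zero => lia
      | succ m ih =>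
        have h₁ : a η n x = a η (n + 1) (f n x) + atNode S (node η n) x := by
          rw [ha η n, hd _ (by simpa [node] using hn)]
          rfl
        have h₂ : a η (n + 1) (f n x) - atBranch S η (n + 1) (f n x) ∈
            LinearMap.range (relation κ f) := by
          by_cases hn' : N ≤ n + 1
          · rw [haT η hη _ hn', sub_self]
            exact zero_mem _
          · exact ih (n + 1) (f n x) hn' (by lia)
        have h₃ := sub_mem h₂ (LinearMap.mem_range_self (relation κ f) (Finsupp.single (η, n) x))
        convert h₃ using 1
        rw [relation_single, h₁]
        abel

end Definitions

section

variable {R : Type u} [Ring R] {E : Type u} [AddCommGroup E] [Module Rᵐᵒᵖ E]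
  [Module.Free Rᵐᵒᵖ E]

/-- The tree module is flat Mittag-Leffler. -/
theorem isFlatML (κ : Type u) (f : ℕ → E →ₗ[Rᵐᵒᵖ] E) :
    IsFlatML R (Gen E κ ⧸ LinearMap.range (relation κ f)) := by
  classical
  refine IsFlatML.of_locally_retract fun m x => ?_
  choose p hp using fun k => Submodule.mkQ_surjective (LinearMap.range (relation κ f)) (x k)
  let T : Finset (ℕ → κ) := Finset.univ.biUnion fun k => (p k).2.support.image Prod.fst
  obtain ⟨N, hN⟩ : ∃ N, ∀ η ∈ T, ∀ τ ∈ T, node η N = node τ N → η = τ := by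
    have : ∀ q : (ℕ → κ) × (ℕ → κ), ∃ N, ∀ n ≥ N, node q.1 n = node q.2 n → q.1 = q.2 := by
      intro q
      by_cases h : q.1 = q.2
      · exact ⟨0, fun _ _ _ => h⟩
      · obtain ⟨N, hN⟩ := exists_node_ne h
        exact ⟨N, fun n hn he => absurd he (hN n hn)⟩
    choose K hK using this
    exact ⟨(T ×ˢ T).sup K, fun η hη τ hτ => hK (η, τ) _
      (Finset.le_sup (f := K) (Finset.mk_mem_product hη hτ))⟩
  -- High enough to separate the branches in `T`, and strictly above every node occurring in the
  -- chosen representatives; hence the + 1.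
  let N' := max N ((Finset.univ.biUnion fun k => (p k).1.support.image Sigma.fst).sup id + 1)
  obtain ⟨α, hα, hαd, hαy⟩ := exists_approx f T N' fun η hη τ hτ h =>
    hN η hη τ hτ (node_eq_of_le (le_max_left _ _) h)
  refine ⟨Gen E κ, _, _, Submodule.liftQ _ α ?_, Submodule.mkQ _, isFlatML_of_free, fun k => ?_⟩
  · rintro _ ⟨z, rfl⟩
    exact hα z
  · rw [← hp k]
    refine map_eq_of_support (φ := Submodule.mkQ _ ∘ₗ α) (ψ := Submodule.mkQ _) (p k)
      (fun s hs x => ?_) fun i hi x => ?_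
    · rw [LinearMap.comp_apply, hαd s ?_ x]
      refine lt_of_lt_of_le (Nat.lt_succ_of_le ?_) (le_max_right _ _)
      refine Finset.le_sup (f := id) (Finset.mem_biUnion.2 ⟨k, Finset.mem_univ _, ?_⟩)
      exact Finset.mem_image_of_mem _ hs
    · rw [LinearMap.comp_apply, Submodule.mkQ_apply, Submodule.mkQ_apply, Submodule.Quotient.eq]
      exact hαy _ (Finset.mem_biUnion.2 ⟨k, Finset.mem_univ _, Finset.mem_image_of_mem _ hi⟩) _ _

end

/-! ### A cardinal κ with 2^κ ≤ κ^ω. -/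

section Counting

/-- Iterated power sets of `H ⊕ ℕ`. -/
def Tower (H : Type u) : ℕ → Type u
  | 0 => H ⊕ ULift.{u} ℕ
  | n + 1 => Set (Tower H n)

/-- The union of the iterated power sets of `H ⊕ ℕ`, of strong limit cardinality of countable
cofinality. -/
abbrev Limit (H : Type u) : Type u := Σ n, Tower H n

/-- A subset is determined by its slices at the levels, and its slice at level n is itself an
element of level n + 1. -/
theorem mk_set_limit_le (H : Type u) :
    Cardinal.mk (Set (Limit H)) ≤ Cardinal.mk (ℕ → Limit H) := by
  refine Cardinal.mk_le_of_injective
    (f := fun s n => (⟨n + 1, show Set (Tower H n) from {x | (⟨n, x⟩ : Limit H) ∈ s}⟩ : Limit H))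
    fun s t h => ?_
  ext ⟨n, x⟩
  have h' := sigma_mk_injective (congrFun h n)
  exact Set.ext_iff.1 h' x

/-- With κ the cardinality of `Limit H` there are κ nodes, and |H| ≤ κ, so there are at most 2^κ ≤
κ^ω functions on the nodes, fewer than the 2^(κ^ω) sets of branches. -/
theorem not_injective_of_limit (H : Type u) (φ : Set (ℕ → Limit H) → Node (Limit H) → H) :
    ¬ Function.Injective φ := by
  intro hφ
  have : Infinite (Limit H) := Infinite.of_injective
    (fun n : ℕ => (⟨0, show H ⊕ ULift.{u} ℕ from Sum.inr ⟨n⟩⟩ : Limit H)) fun m n h => by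
      have h' : (Sum.inr ⟨m⟩ : H ⊕ ULift.{u} ℕ) = Sum.inr ⟨n⟩ :=
        sigma_mk_injective (β := Tower H) h
      simpa using h'
  have hnode : Cardinal.mk (Node (Limit H)) = Cardinal.mk (Limit H) := by
    rw [← Cardinal.mk_congr List.equivSigmaTuple, Cardinal.mk_list_eq_mk]
  have hH : Cardinal.mk H ≤ Cardinal.mk (Limit H) :=
    Cardinal.mk_le_of_injective (f := fun x => (⟨0, show H ⊕ ULift.{u} ℕ from Sum.inl x⟩ : Limit H))
      fun x y h => by
        have h' : (Sum.inl x : H ⊕ ULift.{u} ℕ) = Sum.inl y :=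
          sigma_mk_injective (β := Tower H) h
        simpa using h'
  have hinf : Cardinal.aleph0 ≤ Cardinal.mk (Limit H) := Cardinal.aleph0_le_mk _
  have h₁ := Cardinal.mk_le_of_injective hφ
  have h₂ : Cardinal.mk (Node (Limit H) → H) ≤ Cardinal.mk (ℕ → Limit H) := by
    refine le_trans ?_ (mk_set_limit_le H)
    rw [← Cardinal.power_def, hnode, Cardinal.mk_set]
    calc Cardinal.mk H ^ Cardinal.mk (Limit H)
        ≤ (2 ^ Cardinal.mk (Limit H)) ^ Cardinal.mk (Limit H) :=
          Cardinal.power_le_power_right (hH.trans (Cardinal.cantor _).le)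
      _ = 2 ^ Cardinal.mk (Limit H) := by
          rw [← Cardinal.power_mul, Cardinal.mul_eq_self hinf]
  have h₃ := (h₁.trans h₂)
  rw [Cardinal.mk_set] at h₃
  exact (Cardinal.cantor _).not_ge h₃

end Counting

end TreeModule

open TreeModule in
/-- The `Ext`-orthogonal of the flat Mittag-Leffler modules does not see the cokernel of
`chainMap f`. -/
theorem exists_extension_chainMap {R : Type u} [Ring R] {E C : Type u} [AddCommGroup E]
    [Module Rᵐᵒᵖ E] [Module.Free Rᵐᵒᵖ E] [AddCommGroup C] [Module Rᵐᵒᵖ C]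
    (hC : rightExtOrthogonal (flatMittagLefflerModules R) (ModuleCat.of Rᵐᵒᵖ C))
    (f : ℕ → E →ₗ[Rᵐᵒᵖ] E) (g : (ℕ →₀ E) →ₗ[Rᵐᵒᵖ] C) :
    ∃ g' : (ℕ →₀ E) →ₗ[Rᵐᵒᵖ] C, g' ∘ₗ chainMap f = g := by
  classical
  by_contra hg
  let κ := Limit (E →ₗ[Rᵐᵒᵖ] C)
  -- For each set `s` of branches, the map to be extended is `g` on the branches in `s` and 0 on the
  -- others.
  have hext : ∀ s : Set (ℕ → κ), ∃ ψ : Gen E κ →ₗ[Rᵐᵒᵖ] C, ψ ∘ₗ relation κ f =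
      Finsupp.lsum ℕ fun p => if p.1 ∈ s then g ∘ₗ Finsupp.lsingle p.2 else 0 := fun s =>
    exists_extension_of_subsingleton_ext (relation_injective f)
      (Submodule.mkQ_surjective _) (LinearMap.exact_map_mkQ_range _)
      (hC _ ((flatMittagLefflerModules_iff _).2 (isFlatML κ f))) _
  choose ψ hψ using hext
  refine not_injective_of_limit (E →ₗ[Rᵐᵒᵖ] C) (fun s n => ψ s ∘ₗ atNode Rᵐᵒᵖ n) fun s t hst => ?_
  have key : ∀ s t : Set (ℕ → κ), (∀ n, ψ s ∘ₗ atNode Rᵐᵒᵖ n = ψ t ∘ₗ atNode Rᵐᵒᵖ n) →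
      s ⊆ t := by
    intro s t hst η hs
    by_contra ht
    -- On a branch in `s` but not in `t`, the node terms cancel in `ψ s - ψ t`; what remains is an
    -- extension of `g`, which was assumed not to exist.
    refine hg ⟨Finsupp.lsum ℕ fun n => (ψ s - ψ t) ∘ₗ atBranch Rᵐᵒᵖ η n, ?_⟩
    refine Finsupp.lhom_ext' fun n => LinearMap.ext fun x => ?_
    have h₁ := LinearMap.congr_fun (hψ s) (Finsupp.single (η, n) x)
    have h₂ := LinearMap.congr_fun (hψ t) (Finsupp.single (η, n) x)
    have h₃ := LinearMap.congr_fun (hst (node η n)) x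
    simp only [LinearMap.comp_apply, relation_single, map_sub, Finsupp.lsum_single, hs, ht,
      if_true, if_false, LinearMap.zero_apply, Finsupp.lsingle_apply] at h₁ h₂ h₃
    simp only [LinearMap.comp_apply, Finsupp.lsingle_apply, chainMap_single, map_sub,
      Finsupp.lsum_single, LinearMap.sub_apply]
    rw [← sub_zero (g _), ← h₂, ← h₁, h₃]
    abel
  exact (key s t (congrFun hst)).antisymm (key t s fun n => (congrFun hst n).symm)

/-! ### Bass's theorem on principal left ideals, and left Noetherian right perfect rings. -/

section Rings

/-- Every descending chain of principal left ideals `R a₀ ⊇ R a₁ a₀ ⊇ ⋯` stabilizes. -/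
def PrincipalLeftChainsStabilize (R : Type*) [Ring R] : Prop :=
  ∀ a : ℕ → R, ∃ n, ∀ m ≥ n, ∃ r, descendingProd a m = r * descendingProd a (m + 1)

variable {R A : Type*} [Ring R] [Ring A]

theorem PrincipalLeftChainsStabilize.of_surjective (h : PrincipalLeftChainsStabilize R)
    {φ : R →+* A} (hφ : Function.Surjective φ) : PrincipalLeftChainsStabilize A := by
  intro a
  choose b hb using fun n => hφ (a n)
  have hprod : ∀ n, descendingProd a n = φ (descendingProd b n) := by
    intro n
    induction n with
    | zero => simp [descendingProd]
    | succ n ih => simp [descendingProd, ih, hb]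
  obtain ⟨n, hn⟩ := h b
  refine ⟨n, fun m hm => ?_⟩
  obtain ⟨r, hr⟩ := hn m hm
  exact ⟨φ r, by rw [hprod, hprod, hr, map_mul]⟩

theorem PrincipalLeftChainsStabilize.wellFounded (h : PrincipalLeftChainsStabilize A) :
    WellFounded fun x y : A => x ∈ Ideal.span {y} ∧ y ∉ Ideal.span {x} := by
  refine wellFounded_iff_isEmpty_descending_chain.2 ⟨fun ⟨x, hx⟩ => ?_⟩
  choose a ha using fun n => Ideal.mem_span_singleton'.1 (hx n).1
  -- Putting `x 0` in front of the multipliers makes the product of length n + 1 equal to `x n`.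
  have hprod : ∀ n, descendingProd (fun n => Nat.casesOn n (x 0) a) (n + 1) = x n := by
    intro n
    induction n with
    | zero => simp [descendingProd]
    | succ n ih => rw [descendingProd, ih]; exact ha n
  obtain ⟨n, hn⟩ := h fun n => Nat.casesOn n (x 0) a
  obtain ⟨r, hr⟩ := hn (n + 1) n.le_succ
  rw [hprod, hprod] at hr
  exact (hx n).2 (Ideal.mem_span_singleton'.2 ⟨r, hr.symm⟩)

/-- A minimal nonzero principal left ideal inside `I` is a minimal left ideal, since any nonzero
left ideal below it contains a nonzero principal one. -/
theorem exists_isAtom_le (h : PrincipalLeftChainsStabilize A) {I : Ideal A} (hI : I ≠ ⊥) :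
    ∃ K ≤ I, IsAtom K := by
  obtain ⟨x₀, hx₀, hx₀'⟩ := Submodule.exists_mem_ne_zero_of_ne_bot hI
  obtain ⟨x, ⟨hxI, hx⟩, hmin⟩ := h.wellFounded.has_min {x | x ∈ I ∧ x ≠ 0} ⟨x₀, hx₀, hx₀'⟩
  refine ⟨Ideal.span {x}, (Ideal.span_singleton_le_iff_mem _).2 hxI,
    fun h0 => hx (Ideal.span_singleton_eq_bot.1 h0), fun K hK => ?_⟩
  by_contra hK0
  obtain ⟨y, hy, hy0⟩ := Submodule.exists_mem_ne_zero_of_ne_bot hK0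
  have hyx : y ∈ Ideal.span {x} := hK.le hy
  have hyI : y ∈ I := (Ideal.span_singleton_le_iff_mem _).2 hxI hyx
  have := hmin y ⟨hyI, hy0⟩
  push Not at this
  refine hK.not_ge ((Ideal.span_singleton_le_iff_mem _).2 ?_)
  exact (Ideal.span_singleton_le_iff_mem _).2 hy (this hyx)

/-- As the radical is zero, some maximal left ideal does not contain `I`; minimality of one and
maximality of the other make them complementary. -/
theorem exists_isCompl_of_isAtom (hJ : Ring.jacobson A = ⊥) {I : Ideal A} (hI : IsAtom I) :
    ∃ m, IsCompl I m := by
  obtain ⟨m, hm, hIm⟩ : ∃ m : Ideal A, IsCoatom m ∧ ¬ I ≤ m := by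
    by_contra! hall
    have hle : I ≤ Ring.jacobson A := le_sInf fun m hm => hall m hm
    exact hI.1 (le_bot_iff.1 (hJ ▸ hle))
  exact ⟨m, hI.not_le_iff_disjoint.1 hIm, (hm.not_le_iff_codisjoint.1 hIm).symm⟩

/-- Among the principal left ideals with a semisimple complement take a minimal one. Were it
nonzero, a minimal left ideal could be split off from it and moved to the complement, leaving a
smaller such ideal. -/
theorem isSemisimpleRing_of_chains (h : PrincipalLeftChainsStabilize A)
    (hJ : Ring.jacobson A = ⊥) : IsSemisimpleRing A := by
  have hbot : IsSemisimpleModule A (⊥ : Ideal A) :=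
    (isSemisimpleModule_iff A _).2 ⟨fun K => ⟨⊤, by
      rw [Subsingleton.elim K ⊥]; exact isCompl_bot_top⟩⟩
  obtain ⟨x, ⟨L, hL, hxL⟩, hmin⟩ := h.wellFounded.has_min
    {x | ∃ L : Ideal A, IsSemisimpleModule A L ∧ IsCompl (Ideal.span {x}) L}
    ⟨1, ⊥, hbot, by rw [Ideal.span_singleton_one]; exact isCompl_top_bot⟩
  by_cases hx : Ideal.span {x} = ⊥
  · rw [hx] at hxL
    have hL' : L = ⊤ := by simpa using hxL.sup_eq_top
    subst hL'
    exact IsSemisimpleModule.congr Submodule.topEquiv.symm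
  exfalso
  obtain ⟨I, hIx, hI⟩ := exists_isAtom_le h hx
  obtain ⟨m, hm⟩ := exists_isCompl_of_isAtom hJ hI
  have hsup : I ⊔ m ⊓ Ideal.span {x} = Ideal.span {x} := by
    rw [← sup_inf_assoc_of_le m hIx, hm.sup_eq_top, top_inf_eq]
  have hcompl : IsCompl (m ⊓ Ideal.span {x}) (I ⊔ L) := by
    constructor
    · refine Submodule.disjoint_def.2 fun y hy hy' => ?_
      obtain ⟨i, hi, l, hl, rfl⟩ := Submodule.mem_sup.1 hy'
      have hl0 : l = 0 := by
        refine Submodule.disjoint_def.1 hxL.disjoint l ?_ hl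
        have := sub_mem hy.2 (hIx hi)
        simpa using this
      subst hl0
      rw [add_zero] at hy ⊢
      exact Submodule.disjoint_def.1 hm.disjoint i hi hy.1
    · rw [codisjoint_iff, ← sup_assoc, sup_comm _ I, hsup, hxL.sup_eq_top]
  have hsimple : IsSimpleModule A I := isSimpleModule_iff_isAtom.2 hI
  -- The remaining summand must again be principal; as a direct summand of the ring it is generated
  -- by its component `k` of 1.
  obtain ⟨k, hk, l, hl, hkl⟩ := Submodule.mem_sup.1
    (hcompl.sup_eq_top ▸ Submodule.mem_top : (1 : A) ∈ m ⊓ Ideal.span {x} ⊔ (I ⊔ L))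
  have hspan : Ideal.span {k} = m ⊓ Ideal.span {x} := by
    refine le_antisymm ((Ideal.span_singleton_le_iff_mem _).2 hk) fun y hy => ?_
    have h1 : y * k + y * l = y := by rw [← mul_add, hkl, mul_one]
    have h2 : y * l = 0 := by
      refine Submodule.disjoint_def.1 hcompl.disjoint _ ?_ (Ideal.mul_mem_left _ _ hl)
      rw [← eq_sub_iff_add_eq'] at h1
      rw [h1]
      exact sub_mem hy (Ideal.mul_mem_left _ _ hk)
    rw [h2, add_zero] at h1
    exact Ideal.mem_span_singleton'.2 ⟨y, h1⟩
  refine hmin k ⟨I ⊔ L, IsSemisimpleModule.sup inferInstance hL, hspan ▸ hcompl⟩ ⟨hk.2, ?_⟩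
  rw [hspan]
  intro hxm
  have hIm : I ≤ m := hIx.trans ((Ideal.span_singleton_le_iff_mem _).2 hxm.1)
  exact hI.1 (le_bot_iff.1 (hm.disjoint le_rfl hIm))

/-- A ring whose descending chains of principal left ideals stabilize is right perfect. -/
theorem isRightPerfect_of_chains (h : PrincipalLeftChainsStabilize R) : IsRightPerfect R where
  isSemisimpleRing := isSemisimpleRing_of_chains
    (h.of_surjective (φ := Ideal.Quotient.mk (Ring.jacobson R)) Ideal.Quotient.mk_surjective)
    (Ring.jacobson_quotient_jacobson R)
  rightTNilpotent a ha := by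
    obtain ⟨n, hn⟩ := h a
    obtain ⟨r, hr⟩ := hn n le_rfl
    refine ⟨n, ?_⟩
    have hj := ha n
    rw [← Ideal.jacobson_bot, Ideal.mem_jacobson_iff] at hj
    -- With pₙ the product, pₙ = r aₙ pₙ, so 1 - r aₙ kills pₙ; as aₙ lies in the radical, `z` is a
    -- left inverse of 1 - r aₙ.
    obtain ⟨z, hz⟩ := hj (-r)
    rw [Ideal.mem_bot, sub_eq_zero] at hz
    have h1 : (z * -r * a n + z) * descendingProd a n = 0 := by
      have : z * descendingProd a n = z * (r * descendingProd a (n + 1)) := by rw [← hr]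
      rw [add_mul, this, descendingProd]
      simp [mul_assoc]
    rwa [hz, one_mul] at h1

/-- The right annihilator of the `k`-th power of a two-sided ideal. -/
def rightAnnihilatorPow (J : Ideal R) [J.IsTwoSided] (k : ℕ) : Ideal R where
  carrier := {x | ∀ y ∈ J ^ k, y * x = 0}
  add_mem' hx hx' y hy := by rw [mul_add, hx y hy, hx' y hy, add_zero]
  zero_mem' y _ := mul_zero y
  smul_mem' s x hx y hy := by
    rw [smul_eq_mul, ← mul_assoc]
    exact hx _ (Ideal.mul_mem_right _ _ hy)

/-- A left Noetherian right perfect ring is left Artinian. -/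
theorem IsRightPerfect.isArtinianRing (h : IsRightPerfect R) [IsNoetherianRing R] :
    IsArtinianRing R := by
  have hnil : IsNilpotent (Ring.jacobson R) := by
    set J := Ring.jacobson R
    have hmono : Monotone (rightAnnihilatorPow J) := fun k l hkl x hx y hy =>
      hx y (Ideal.pow_le_pow_right hkl hy)
    obtain ⟨n, hn⟩ := monotone_stabilizes_iff_noetherian.2 ‹IsNoetherianRing R›
      ⟨rightAnnihilatorPow J, hmono⟩
    refine ⟨n, ?_⟩
    by_contra hne
    obtain ⟨y, hy, hy0⟩ := Submodule.exists_mem_ne_zero_of_ne_bot hne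
    have h1 : (1 : R) ∉ rightAnnihilatorPow J n := fun h1 => hy0 (by simpa using h1 y hy)
    -- If Jx lay in the annihilator of Jⁿ, then Jⁿ⁺¹ would kill x, hence so would Jⁿ by
    -- stabilization. Iterating from 1 builds a sequence in J whose products never vanish, against
    -- T-nilpotence.
    have hstep : ∀ x : {x // x ∉ rightAnnihilatorPow J n},
        ∃ a ∈ J, a * x.1 ∉ rightAnnihilatorPow J n := by
      intro x
      by_contra! hall
      refine x.2 ?_
      have : rightAnnihilatorPow J n = rightAnnihilatorPow J (n + 1) := hn (n + 1) n.le_succ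
      refine this.ge fun y hy => ?_
      rw [Submodule.pow_succ] at hy
      induction hy using Submodule.mul_induction_on' with
      | mem_mul_mem p hp q hq => rw [mul_assoc]; exact hall q hq p hp
      | add p _ q _ hp hq => rw [add_mul, hp, hq, add_zero]
    choose a haJ ha using hstep
    let x : ℕ → {x // x ∉ rightAnnihilatorPow J n} :=
      fun k => Nat.rec ⟨1, h1⟩ (fun _ x => ⟨a x * x.1, ha x⟩) k
    obtain ⟨k, hk⟩ := h.rightTNilpotent (fun k => a (x k)) fun k => haJ _
    have hx : ∀ k, descendingProd (fun k => a (x k)) k = (x k).1 := by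
      intro k
      induction k with
      | zero => rfl
      | succ k ih => rw [descendingProd, ih]
    exact (x k).2 (by rw [← hx, hk]; exact zero_mem _)
  have := h.isSemisimpleRing
  have : IsSemiprimaryRing R := ⟨h.isSemisimpleRing, hnil⟩
  exact IsSemiprimaryRing.isNoetherian_iff_isArtinian.1 ‹IsNoetherianRing R›

end Rings

/-! ### Bass modules, and failure of D to be a left orthogonal. -/

section Bass

open BalancedTensor

variable {R : Type u} [Ring R]

/-- `chainMap f` is a free resolution of length one, so vanishing of Ext¹ amounts to extending maps
along it. -/
theorem leftExtOrthogonal_coker_chainMap {E : Type u} [AddCommGroup E] [Module Rᵐᵒᵖ E]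
    [Module.Free Rᵐᵒᵖ E] (f : ℕ → E →ₗ[Rᵐᵒᵖ] E) {X : Type u} [AddCommGroup X] [Module Rᵐᵒᵖ X]
    {p : (ℕ →₀ E) →ₗ[Rᵐᵒᵖ] X} (hp : Function.Surjective p)
    (hfp : Function.Exact (chainMap f) p) :
    leftExtOrthogonal (rightExtOrthogonal (flatMittagLefflerModules R)) (ModuleCat.of Rᵐᵒᵖ X) :=
  fun C hC => subsingleton_ext_of_exists_extension (C := C) (chainMap_injective f) hp hfp
    fun g => exists_extension_chainMap hC f g

/-- The direct limit of `R → R → ⋯` along the left multiplications by `a₀, a₁, …`. -/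
abbrev BassModule (a : ℕ → R) : Type u :=
  (ℕ →₀ Rᵐᵒᵖ) ⧸ LinearMap.range
    (chainMap fun n => LinearMap.toSpanSingleton Rᵐᵒᵖ Rᵐᵒᵖ (MulOpposite.op (a n)))

theorem coordLeft_mapLeft_chainMap_zero (a : ℕ → R) {Q : Type*} [AddCommGroup Q] [Module R Q]
    (w : BalancedTensor R (ℕ →₀ Rᵐᵒᵖ) Q) :
    coordLeft R ℕ Q (mapLeft Q
      (chainMap fun n => LinearMap.toSpanSingleton Rᵐᵒᵖ Rᵐᵒᵖ (MulOpposite.op (a n))) w) 0 =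
      coordLeft R ℕ Q w 0 := by
  induction w using BalancedTensor.induction_on with
  | zero => simp
  | tmul k q => simp [chainMap_apply_zero]
  | add x y hx hy => simp [hx, hy]

theorem coordLeft_mapLeft_chainMap_succ (a : ℕ → R) {Q : Type*} [AddCommGroup Q] [Module R Q]
    (w : BalancedTensor R (ℕ →₀ Rᵐᵒᵖ) Q) (n : ℕ) :
    coordLeft R ℕ Q (mapLeft Q
      (chainMap fun n => LinearMap.toSpanSingleton Rᵐᵒᵖ Rᵐᵒᵖ (MulOpposite.op (a n))) w) (n + 1) =
      coordLeft R ℕ Q w (n + 1) - a n • coordLeft R ℕ Q w n := by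
  induction w using BalancedTensor.induction_on with
  | zero => simp
  | tmul k q => simp [chainMap_apply_succ, sub_smul, mul_smul]
  | add x y hx hy => simp only [map_add, Finsupp.add_apply, hx, hy, smul_add]; abel

/-- Let pₙ be the descending products. In the limit e₀ = eₙpₙ, so e₀ ⊗ (1 mod R pᵢ)ᵢ vanishes in
every factor, hence vanishes in the tensor product with the product module. Lifting along the
presentation, the coordinates of the lift are forced to be pₙ · (1 mod R pᵢ)ᵢ. -/
theorem BassModule.stabilizes {a : ℕ → R} (h : IsFlatML R (BassModule a)) :
    ∃ n, ∀ m ≥ n, ∃ r, descendingProd a m = r * descendingProd a (m + 1) := by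
  set f : ℕ → Rᵐᵒᵖ →ₗ[Rᵐᵒᵖ] Rᵐᵒᵖ :=
    fun n => LinearMap.toSpanSingleton Rᵐᵒᵖ Rᵐᵒᵖ (MulOpposite.op (a n)) with hf
  let π := (LinearMap.range (chainMap f)).mkQ
  have hπ : ∀ n, π (Finsupp.single 0 1) =
      π (Finsupp.single n (MulOpposite.op (descendingProd a n))) := by
    intro n
    induction n with
    | zero => rfl
    | succ n ih =>
      rw [ih]
      refine (Submodule.Quotient.eq _).2
        ⟨Finsupp.single n (MulOpposite.op (descendingProd a n)), ?_⟩
      rw [chainMap_single]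
      simp [hf, descendingProd]
  let Q : ULift.{u} ℕ → Type u := fun i => R ⧸ Ideal.span {descendingProd a i.down}
  let q : ∀ i, Q i := fun i => Submodule.Quotient.mk 1
  have hq : ∀ (r : R) i, r • q i = 0 ↔ r ∈ Ideal.span {descendingProd a i.down} := fun r i => by
    simp only [q]
    rw [← Submodule.Quotient.mk_smul, Submodule.Quotient.mk_eq_zero, smul_eq_mul, mul_one]
  have hz : mapLeft _ π (tmul R (Finsupp.single 0 (1 : Rᵐᵒᵖ)) q) = 0 := by
    refine h _ (ULift ℕ) Q (fun i => LinearMap.proj i) (fun n hn => funext hn) _ fun i => ?_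
    rw [mapLeft_tmul, map_tmul, hπ i.down]
    have : (Finsupp.single i.down (MulOpposite.op (descendingProd a i.down)) : ℕ →₀ Rᵐᵒᵖ) =
        MulOpposite.op (descendingProd a i.down) • Finsupp.single i.down 1 := by simp
    rw [this, map_smul, smul_tmul]
    have h0 : descendingProd a i.down • q i = 0 := (hq _ _).2 (Ideal.mem_span_singleton_self _)
    rw [LinearMap.proj_apply, h0, tmul_zero]
  obtain ⟨w, hw⟩ := exists_mapLeft_eq (f := chainMap f) (Submodule.mkQ_surjective _)
    (fun n hn => (Submodule.Quotient.mk_eq_zero _).1 hn) hz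
  have hc : ∀ n, coordLeft R ℕ _ w n = descendingProd a n • q := by
    intro n
    induction n with
    | zero =>
      rw [← coordLeft_mapLeft_chainMap_zero a w, hw]
      simp [descendingProd]
    | succ n ih =>
      have := coordLeft_mapLeft_chainMap_succ a w n
      rw [hw, ih] at this
      simp only [coordLeft_tmul, Finsupp.single_apply, (Nat.succ_ne_zero n).symm, if_false,
        MulOpposite.unop_zero] at this
      rw [descendingProd, mul_smul, ← sub_eq_zero, ← this]
      exact zero_smul R q
  -- Finite support makes some coordinate zero, which says that pₙ lies in R pᵢ for every i.
  obtain ⟨n, hn⟩ := Infinite.exists_notMem_finset (coordLeft R ℕ _ w).support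
  rw [Finsupp.notMem_support_iff, hc] at hn
  refine ⟨n, fun m hm => ?_⟩
  have hdvd : ∃ t, descendingProd a m = t * descendingProd a n := by
    induction m, hm using Nat.le_induction with
    | base => exact ⟨1, (one_mul _).symm⟩
    | succ m _ ih =>
      obtain ⟨t, ht⟩ := ih
      exact ⟨a m * t, by rw [descendingProd, ht, mul_assoc]⟩
  obtain ⟨t, ht⟩ := hdvd
  obtain ⟨s, hs⟩ := Ideal.mem_span_singleton'.1 ((hq _ ⟨m + 1⟩).1 (congrFun hn ⟨m + 1⟩))
  exact ⟨t * s, by rw [mul_assoc, hs, ht]⟩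

/-- Over a ring that is not right perfect, the flat Mittag-Leffler modules are not the left
`Ext`-orthogonal of any class. -/
theorem not_exists_eq_leftExtOrthogonal (hR : ¬ IsRightPerfect R) :
    ¬ ∃ C : RightModuleClass R, flatMittagLefflerModules R = leftExtOrthogonal C := by
  rintro ⟨C, hC⟩
  refine hR (isRightPerfect_of_chains fun a => BassModule.stabilizes ?_)
  have h := leftExtOrthogonal_coker_chainMap _ (Submodule.mkQ_surjective _)
    (LinearMap.exact_map_mkQ_range
      (chainMap fun n => LinearMap.toSpanSingleton Rᵐᵒᵖ Rᵐᵒᵖ (MulOpposite.op (a n))))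
  have h' : flatMittagLefflerModules R (ModuleCat.of Rᵐᵒᵖ (BassModule a)) := by
    rw [hC]
    -- `C` is contained in D^⊥, so ⊥(D^⊥) is contained in ⊥C = D.
    exact fun N hN => h N fun M hM => (hC ▸ hM : leftExtOrthogonal C M) N hN
  exact (flatMittagLefflerModules_iff _).1 h'

end Bass

/-! ### Products over left Noetherian rings. -/

section Products

variable {R : Type u} [Ring R]

/-- Over a left Noetherian ring, tensoring with a finitely generated module commutes with products
up to monomorphism. -/
theorem eq_zero_of_forall_mapLeft_proj [IsNoetherianRing R] {J : Type*} {M : J → Type*}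
    [∀ j, AddCommGroup (M j)] [∀ j, Module Rᵐᵒᵖ (M j)] {N : Type*} [AddCommGroup N] [Module R N]
    [Module.Finite R N] (z : BalancedTensor R (∀ j, M j) N)
    (hz : ∀ j, mapLeft N (LinearMap.proj j : (∀ j, M j) →ₗ[Rᵐᵒᵖ] M j) z = 0) : z = 0 := by
  obtain ⟨n, y, hy⟩ := Module.Finite.exists_fin (R := R) (M := N)
  let p : (Fin n →₀ R) →ₗ[R] N := Finsupp.linearCombination R y
  have hp : Function.Surjective p := by
    rw [← LinearMap.range_eq_top, Finsupp.range_linearCombination, hy]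
  obtain ⟨s, k, hk⟩ := Module.Finite.exists_fin (R := R) (M := LinearMap.ker p)
  let a' : (Fin s →₀ R) →ₗ[R] LinearMap.ker p := Finsupp.linearCombination R k
  have ha' : Function.Surjective a' := by
    rw [← LinearMap.range_eq_top, Finsupp.range_linearCombination, hk]
  let a : (Fin s →₀ R) →ₗ[R] (Fin n →₀ R) := (LinearMap.ker p).subtype ∘ₗ a'
  have hpa : p ∘ₗ a = 0 := LinearMap.ext fun x => (a' x).2
  have hap : ∀ x, p x = 0 → ∃ c, a c = x := fun x hx => by
    obtain ⟨c, hc⟩ := ha' ⟨x, hx⟩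
    exact ⟨c, congrArg Subtype.val hc⟩
  obtain ⟨z, rfl⟩ := map_surjective hp z
  have hw : ∀ j, ∃ w, BalancedTensor.map R (M j) a w = mapLeft _ (LinearMap.proj j) z := fun j => by
    refine exists_map_eq hp hap ?_
    rw [← mapLeft_map, hz]
  choose w hw using hw
  -- With a finitely generated free second factor, the separately chosen `w j` assemble into one
  -- tensor, coordinate by coordinate.
  let v : BalancedTensor R (∀ j, M j) (Fin s →₀ R) :=
    ∑ l, tmul R (fun j => coordRight R (M j) (Fin s) (w j) l) (Finsupp.single l 1)
  have hv : ∀ j, mapLeft _ (LinearMap.proj j : (∀ j, M j) →ₗ[Rᵐᵒᵖ] M j) v = w j := fun j => by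
    conv_rhs => rw [← sum_tmul_coordRight (w j), Finsupp.sum_fintype _ _ (by simp)]
    simp [v]
  have hvz : BalancedTensor.map R _ a v = z := by
    refine coordRight_injective (Finsupp.ext fun i => funext fun j => ?_)
    have h := congrArg (fun t => coordRight R (M j) (Fin n) t i) (hw j)
    rw [← hv j, ← mapLeft_map] at h
    simp only [coordRight_mapLeft] at h
    exact h
  rw [← hvz, map_map, hpa, map_zero_hom]

/-- Over a left Noetherian ring the flat Mittag-Leffler modules are closed under products. -/
theorem closedUnderProducts_of_isNoetherianRing [IsNoetherianRing R] :
    ClosedUnderProducts (flatMittagLefflerModules R) := by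
  intro J M hM
  refine (flatMittagLefflerModules_iff _).2 ?_
  simp only [flatMittagLefflerModules_iff] at hM
  intro N _ _ I Q _ _ g hg z hz
  obtain ⟨n, x, y, rfl⟩ := exists_eq_sum z
  let N₀ : Submodule R N := Submodule.span R (Set.range y)
  have : Module.Finite R N₀ := Module.Finite.span_of_finite R (Set.finite_range y)
  let y₀ : Fin n → N₀ := fun k => ⟨y k, Submodule.subset_span ⟨k, rfl⟩⟩
  let z₀ : BalancedTensor R (∀ j, M j) N₀ := ∑ k, tmul R (x k) (y₀ k)
  have hz₀ : BalancedTensor.map R (∀ j, M j) N₀.subtype z₀ = ∑ k, tmul R (x k) (y k) := by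
    simp [z₀, y₀]
  -- The family `g` stays jointly injective on the finitely generated `N₀`, so each flat
  -- Mittag-Leffler factor `M j` kills its component of `z₀`.
  have h0 : z₀ = 0 := eq_zero_of_forall_mapLeft_proj z₀ fun j => by
    refine hM j N₀ I Q (fun i => g i ∘ₗ N₀.subtype) (fun n hn => Subtype.ext (hg _ hn)) _
      fun i => ?_
    rw [← mapLeft_map, ← map_map, hz₀, hz i, map_zero]
  change ∑ k, tmul R (x k) (y k) = 0
  rw [← hz₀, h0, map_zero]

end Products

/-- The character module of a left module, as a right module. -/
def CharDual (N : Type*) [AddCommGroup N] : Type _ := N →+ AddCircle (1 : ℚ)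

/-! ### Character duality and the tensor-Hom adjunction. -/

namespace CharDual

variable {R : Type*} [Ring R] {M N N' : Type*} [AddCommGroup M] [Module Rᵐᵒᵖ M]
  [AddCommGroup N] [Module R N] [AddCommGroup N'] [Module R N']

instance : AddCommGroup (CharDual N) := inferInstanceAs (AddCommGroup (N →+ AddCircle (1 : ℚ)))

instance : FunLike (CharDual N) N (AddCircle (1 : ℚ)) :=
  inferInstanceAs (FunLike (N →+ AddCircle (1 : ℚ)) N (AddCircle (1 : ℚ)))

instance : AddMonoidHomClass (CharDual N) N (AddCircle (1 : ℚ)) :=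
  inferInstanceAs (AddMonoidHomClass (N →+ AddCircle (1 : ℚ)) N (AddCircle (1 : ℚ)))

theorem ext {φ ψ : CharDual N} (h : ∀ n, φ n = ψ n) : φ = ψ := DFunLike.ext _ _ h

theorem add_apply (φ ψ : CharDual N) (n : N) : (φ + ψ) n = φ n + ψ n := rfl

theorem zero_apply (n : N) : (0 : CharDual N) n = 0 := rfl

instance : SMul Rᵐᵒᵖ (CharDual N) :=
  ⟨fun r φ => AddMonoidHom.comp φ (DistribSMul.toAddMonoidHom N r.unop)⟩

theorem smul_apply (r : Rᵐᵒᵖ) (φ : CharDual N) (n : N) : (r • φ) n = φ (r.unop • n) := rfl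

instance : Module Rᵐᵒᵖ (CharDual N) where
  one_smul φ := ext fun n => by simp [smul_apply]
  mul_smul r s φ := ext fun n => by simp [smul_apply, mul_smul]
  smul_zero r := rfl
  smul_add r φ ψ := rfl
  add_smul r s φ := ext fun n => by simp [smul_apply, add_apply, add_smul]
  zero_smul φ := ext fun n => by simp [smul_apply, zero_apply]

/-- The dual of a homomorphism of left modules. -/
def map (f : N →ₗ[R] N') : CharDual N' →ₗ[Rᵐᵒᵖ] CharDual N where
  toFun φ := AddMonoidHom.comp φ f.toAddMonoidHom
  map_add' _ _ := rfl
  map_smul' r φ := ext fun n => by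
    change φ (r.unop • f n) = φ (f (r.unop • n))
    rw [f.map_smul]

theorem map_apply (f : N →ₗ[R] N') (φ : CharDual N') (n : N) : map f φ n = φ (f n) := rfl

theorem exists_extension {A B : Type*} [AddCommGroup A] [AddCommGroup B] {i : A →+ B}
    (hi : Function.Injective i) (χ : A →+ AddCircle (1 : ℚ)) :
    ∃ χ' : B →+ AddCircle (1 : ℚ), ∀ a, χ' (i a) = χ a := by
  obtain ⟨χ', h⟩ := CharacterModule.dual_surjective_of_injective (R := ℤ) i.toIntLinearMap hi χ
  exact ⟨χ', fun a => DFunLike.congr_fun h a⟩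

/-- The additive map `M ⊗_R N → ℚ/ℤ` corresponding to a homomorphism `M → Hom(N, ℚ/ℤ)`. -/
def uncurry (g : M →ₗ[Rᵐᵒᵖ] CharDual N) : BalancedTensor R M N →+ AddCircle (1 : ℚ) :=
  lift (show M →+ N →+ AddCircle (1 : ℚ) from g.toAddMonoidHom) fun m r n => by
    change g (MulOpposite.op r • m) n = g m (r • n)
    rw [map_smul, smul_apply, MulOpposite.unop_op]

/-- The homomorphism `M → Hom(N, ℚ/ℤ)` corresponding to an additive map `M ⊗_R N → ℚ/ℤ`. -/
def curry (χ : BalancedTensor R M N →+ AddCircle (1 : ℚ)) : M →ₗ[Rᵐᵒᵖ] CharDual N where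
  toFun m := AddMonoidHom.mk' (fun n => χ (tmul R m n)) fun n n' => by rw [tmul_add, map_add]
  map_add' m m' := ext fun n => by
    change χ _ = χ _ + χ _
    rw [add_tmul, map_add]
  map_smul' r m := ext fun n => by
    change χ (tmul R (r • m) n) = χ (tmul R m (r.unop • n))
    rw [← smul_tmul, MulOpposite.op_unop]

end CharDual

/-! ### Modules in the double orthogonal are flat. -/

section Cotorsion

variable {R : Type u} [Ring R]

theorem exact_subtype_ker {S A B : Type*} [Ring S] [AddCommGroup A] [Module S A] [AddCommGroup B]
    [Module S B] (p : A →ₗ[S] B) : Function.Exact (LinearMap.ker p).subtype p := fun x =>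
  ⟨fun hx => ⟨⟨x, hx⟩, rfl⟩, by rintro ⟨y, rfl⟩; exact y.2⟩

theorem linearCombination_id_surjective (S A : Type*) [Ring S] [AddCommGroup A] [Module S A] :
    Function.Surjective (Finsupp.linearCombination S (id : A → A)) := fun a =>
  ⟨Finsupp.single a 1, by simp⟩

/-- The kernel of a homomorphism onto a flat module is a pure submodule. -/
theorem IsFlat.mapLeft_subtype_ker_injective {X B : Type u} [AddCommGroup X] [Module Rᵐᵒᵖ X]
    [AddCommGroup B] [Module Rᵐᵒᵖ B] (hX : IsFlat R X) {p : B →ₗ[Rᵐᵒᵖ] X}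
    (hp : Function.Surjective p) (Q : Type u) [AddCommGroup Q] [Module R Q] :
    Function.Injective (mapLeft (R := R) Q (LinearMap.ker p).subtype) :=
  hX.mapLeft_injective (LinearMap.ker p).injective_subtype hp (fun a => a.2)
    (fun b hb => ⟨⟨b, hb⟩, rfl⟩) Q

/-- Character modules are cotorsion. -/
theorem IsFlat.subsingleton_ext_charDual {X Q : Type u} [AddCommGroup X] [Module Rᵐᵒᵖ X]
    [AddCommGroup Q] [Module R Q] (hX : IsFlat R X) :
    Subsingleton (Abelian.Ext (ModuleCat.of Rᵐᵒᵖ X) (ModuleCat.of Rᵐᵒᵖ (CharDual Q)) 1) := by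
  let p : (X →₀ Rᵐᵒᵖ) →ₗ[Rᵐᵒᵖ] X := Finsupp.linearCombination Rᵐᵒᵖ (id : X → X)
  have hp : Function.Surjective p := linearCombination_id_surjective _ _
  refine subsingleton_ext_of_exists_extension (A := LinearMap.ker p)
    (i := (LinearMap.ker p).subtype) (LinearMap.ker p).injective_subtype hp
    (exact_subtype_ker p) fun g => ?_
  -- By adjunction, extending `g` means extending a character of ker p ⊗ Q to the tensor product of
  -- the free cover with Q, and purity makes the map between them injective.
  have hinj := hX.mapLeft_subtype_ker_injective hp Q
  obtain ⟨χ, hχ⟩ := CharDual.exists_extension hinj (CharDual.uncurry g)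
  exact ⟨CharDual.curry χ, LinearMap.ext fun a => CharDual.ext fun n => hχ (tmul R a n)⟩

/-- Modules in the double `Ext`-orthogonal of the flat Mittag-Leffler modules are flat. -/
theorem isFlat_of_leftExtOrthogonal {M : Type u} [AddCommGroup M] [Module Rᵐᵒᵖ M]
    (hM : leftExtOrthogonal (rightExtOrthogonal (flatMittagLefflerModules R))
      (ModuleCat.of Rᵐᵒᵖ M)) : IsFlat R M := by
  intro N N' _ _ _ _ f hf
  refine (injective_iff_map_eq_zero _).2 fun z hz => ?_
  by_contra hz0
  obtain ⟨χ, hχ⟩ := CharacterModule.exists_character_apply_ne_zero_of_ne_zero hz0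
  have hC : rightExtOrthogonal (flatMittagLefflerModules R)
      (ModuleCat.of Rᵐᵒᵖ (CharDual (N' ⧸ LinearMap.range f))) := fun X hX =>
    ((flatMittagLefflerModules_iff X).1 hX).isFlat.subsingleton_ext_charDual
  have hinj : Function.Injective (CharDual.map (LinearMap.range f).mkQ) := fun φ ψ h =>
    CharDual.ext fun q => by
      obtain ⟨n, rfl⟩ := Submodule.mkQ_surjective _ q
      exact DFunLike.congr_fun h n
  have hsurj : Function.Surjective (CharDual.map f) := fun φ => by
    obtain ⟨ψ, hψ⟩ := CharDual.exists_extension (i := f.toAddMonoidHom) hf φ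
    exact ⟨ψ, CharDual.ext hψ⟩
  have hexact : Function.Exact (CharDual.map (LinearMap.range f).mkQ) (CharDual.map f) := by
    intro φ
    constructor
    · intro h
      refine ⟨QuotientAddGroup.lift (LinearMap.range f).toAddSubgroup φ ?_,
        CharDual.ext fun n => rfl⟩
      rintro _ ⟨n, rfl⟩
      exact DFunLike.congr_fun h n
    · rintro ⟨φ, rfl⟩
      refine CharDual.ext fun n => ?_
      rw [CharDual.map_apply, CharDual.map_apply, CharDual.zero_apply, Submodule.mkQ_apply,
        (Submodule.Quotient.mk_eq_zero _).2 (LinearMap.mem_range_self f n), map_zero]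
  -- The dual of `f` is onto with kernel the dual of coker f, which lies in D^⊥; so `χ`, seen as a
  -- map to the dual of N, lifts to the dual of N'. Thus `χ` factors through M ⊗ f and cannot detect
  -- `z`.
  obtain ⟨g, hg⟩ := exists_lift_of_subsingleton_ext hinj hsurj hexact (hM _ hC)
    (CharDual.curry χ)
  have h : (CharDual.uncurry g).comp (BalancedTensor.map R M f) = χ := hom_ext fun m n =>
    DFunLike.congr_fun (LinearMap.congr_fun hg m) n
  exact hχ (((DFunLike.congr_fun h z).symm.trans
    (congrArg (CharDual.uncurry g) hz)).trans (map_zero _))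

end Cotorsion

/-! ### Flatness of pure submodules, pure quotients and directed limits of quotients. -/

section FlatClosure

variable {R : Type u} [Ring R] {M A B : Type u} [AddCommGroup M] [Module Rᵐᵒᵖ M]
  [AddCommGroup A] [Module Rᵐᵒᵖ A] [AddCommGroup B] [Module Rᵐᵒᵖ B]

theorem IsFlat.of_injective_pure {i : A →ₗ[Rᵐᵒᵖ] B} (hB : IsFlat R B)
    (hi : ∀ (N : Type u) [AddCommGroup N] [Module R N],
      Function.Injective (mapLeft (R := R) N i)) : IsFlat R A :=
  fun N _ _ _ _ _ f hf => (injective_iff_map_eq_zero _).2 fun z hz =>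
    (injective_iff_map_eq_zero _).1 (hi N) z <| (injective_iff_map_eq_zero _).1 (hB _ _ f hf) _ <| by
      rw [← mapLeft_map, hz, map_zero]

theorem IsFlat.of_linearEquiv (e : A ≃ₗ[Rᵐᵒᵖ] B) (hB : IsFlat R B) : IsFlat R A :=
  IsFlat.of_injective_pure (i := e.toLinearMap) hB fun N _ _ =>
    Function.LeftInverse.injective (g := mapLeft N e.symm.toLinearMap) fun z => by
      rw [mapLeft_mapLeft, LinearEquiv.symm_comp, mapLeft_id]

/-- The quotient of a flat module by a pure submodule is flat. -/
theorem IsFlat.quotient (hM : IsFlat R M) (W : Submodule Rᵐᵒᵖ M)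
    (hW : ∀ (N : Type u) [AddCommGroup N] [Module R N],
      Function.Injective (mapLeft (R := R) N W.subtype)) : IsFlat R (M ⧸ W) := by
  intro N N' _ _ _ _ f hf
  refine (injective_iff_map_eq_zero _).2 fun z hz => ?_
  have hWk : ∀ x, W.mkQ x = 0 → ∃ w, W.subtype w = x := fun x hx =>
    ⟨⟨x, (Submodule.Quotient.mk_eq_zero _).1 hx⟩, rfl⟩
  have hfk : ∀ x, (LinearMap.range f).mkQ x = 0 → ∃ w, f w = x := fun x hx =>
    (Submodule.Quotient.mk_eq_zero _).1 hx
  have hf0 : (LinearMap.range f).mkQ ∘ₗ f = 0 := LinearMap.range_mkQ_comp f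
  have hW0 : W.mkQ ∘ₗ W.subtype = 0 := by ext w; simp
  obtain ⟨z, rfl⟩ := mapLeft_surjective W.mkQ_surjective z
  rw [← mapLeft_map] at hz
  obtain ⟨v, hv⟩ := exists_mapLeft_eq (f := W.subtype) W.mkQ_surjective hWk hz
  -- Purity of W is used on the cokernel of `f`, so that `v` comes from W ⊗ N.
  have hv0 : BalancedTensor.map R W (LinearMap.range f).mkQ v = 0 := by
    refine (injective_iff_map_eq_zero _).1 (hW _) _ ?_
    rw [mapLeft_map, hv, map_map, hf0, map_zero_hom]
  obtain ⟨v, rfl⟩ := exists_map_eq (Submodule.mkQ_surjective _) hfk hv0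
  rw [mapLeft_map] at hv
  rw [← hM _ _ f hf hv, mapLeft_mapLeft, hW0, mapLeft_zero_hom]

/-- Directed unions of submodules with flat quotients have flat quotients. -/
theorem isFlat_quotient_of_directed {ι : Type*} [Nonempty ι] {S : ι → Submodule Rᵐᵒᵖ M}
    {U : Submodule Rᵐᵒᵖ M} (hS : Directed (· ≤ ·) S) (hU : ∀ i, S i ≤ U)
    (hM : ∀ x ∈ U, ∃ j, x ∈ S j) (hF : ∀ i, IsFlat R (M ⧸ S i)) : IsFlat R (M ⧸ U) := by
  intro N N' _ _ _ _ f hf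
  refine (injective_iff_map_eq_zero _).2 fun z hz => ?_
  obtain ⟨z, rfl⟩ := mapLeft_surjective U.mkQ_surjective z
  rw [← mapLeft_map] at hz
  obtain ⟨w, hw⟩ := exists_mapLeft_eq (f := U.subtype) U.mkQ_surjective
    (fun x hx => ⟨⟨x, (Submodule.Quotient.mk_eq_zero _).1 hx⟩, rfl⟩) hz
  obtain ⟨i⟩ := ‹Nonempty ι›
  obtain ⟨j, -, w, rfl⟩ := exists_mapLeft_subtype_eq hS hU hM i w
  have h0 : (S j).mkQ ∘ₗ U.subtype ∘ₗ Submodule.inclusion (hU j) = 0 := by ext w; simp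
  have hj : mapLeft N (S j).mkQ z = 0 := by
    refine (injective_iff_map_eq_zero _).1 (hF j _ _ f hf) _ ?_
    rw [← mapLeft_map, ← hw, mapLeft_mapLeft, mapLeft_mapLeft, LinearMap.comp_assoc, h0,
      mapLeft_zero_hom]
  have hfac : U.mkQ = (S j).liftQ U.mkQ (by rw [Submodule.ker_mkQ]; exact hU j) ∘ₗ (S j).mkQ := by
    ext x; simp
  rw [hfac, ← mapLeft_mapLeft, hj, map_zero]

end FlatClosure

/-! ### Countable pure submodules. -/

section CountablePure

variable {R : Type u} [Ring R] {M : Type u} [AddCommGroup M] [Module Rᵐᵒᵖ M]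

/-- Finite systems of linear equations over the submodule `W` that are solvable in `M` are
solvable in `W`. -/
def IsEquationallyPure (W : Submodule Rᵐᵒᵖ M) : Prop :=
  ∀ (p n : ℕ) (a : Fin p → Fin n → R) (b : Fin n → W),
    (∃ y : Fin p → M, ∀ i, ∑ j, MulOpposite.op (a j i) • y j = b i) →
    ∃ y : Fin p → W, ∀ i, ∑ j, MulOpposite.op (a j i) • y j = b i

/-- Over a free cover of N, vanishing of a tensor in M ⊗ N says that its coordinates solve a finite
linear system in M, with coefficients in the kernel of the cover. A solution in W makes the tensor
vanish already in W ⊗ N. -/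
theorem IsEquationallyPure.mapLeft_injective {W : Submodule Rᵐᵒᵖ M} (hW : IsEquationallyPure W)
    (N : Type*) [AddCommGroup N] [Module R N] :
    Function.Injective (mapLeft (R := R) N W.subtype) := by
  classical
  refine (injective_iff_map_eq_zero _).2 fun z hz => ?_
  let π : (N →₀ R) →ₗ[R] N := Finsupp.linearCombination R id
  have hπ : Function.Surjective π := linearCombination_id_surjective R N
  obtain ⟨z, rfl⟩ := map_surjective hπ z
  rw [mapLeft_map] at hz
  obtain ⟨w, hw⟩ := exists_map_eq (N := LinearMap.ker π) (f := (LinearMap.ker π).subtype) hπ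
    (fun n hn => ⟨⟨n, hn⟩, rfl⟩) hz
  obtain ⟨p, y, h, rfl⟩ := exists_eq_sum w
  have hc : ∀ c, ∑ j, MulOpposite.op ((h j : N →₀ R) c) • y j =
      (coordRight R W N z c : M) := fun c => by
    have := DFunLike.congr_fun (congrArg (coordRight R M N) hw) c
    rw [coordRight_mapLeft] at this
    simpa [Finsupp.finsetSum_apply] using this
  let t : Finset N := (Finset.univ.biUnion fun j => (h j : N →₀ R).support) ∪
    (coordRight R W N z).support
  obtain ⟨y', hy'⟩ := hW p t.card (fun j i => (h j : N →₀ R) (t.equivFin.symm i))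
    (fun i => coordRight R W N z (t.equivFin.symm i)) ⟨y, fun i => hc _⟩
  have hz' : BalancedTensor.map R W (LinearMap.ker π).subtype (∑ j, tmul R (y' j) (h j)) = z := by
    refine coordRight_injective (Finsupp.ext fun c => ?_)
    simp only [map_sum, map_tmul, Finsupp.finsetSum_apply, coordRight_tmul, Submodule.subtype_apply]
    by_cases hct : c ∈ t
    · simpa using hy' (t.equivFin ⟨c, hct⟩)
    · simp only [t, Finset.mem_union, Finset.mem_biUnion, Finset.mem_univ, true_and, not_or,
        not_exists, Finsupp.notMem_support_iff] at hct
      simp [hct.1, hct.2]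
  rw [← hz', map_map, show π ∘ₗ (LinearMap.ker π).subtype = 0 from LinearMap.ext fun k => k.2,
    map_zero_hom]

/-- Finite systems of linear equations over a countable submodule are solvable in a larger
countable submodule if they are solvable at all. -/
theorem exists_countable_solutions [Countable R] (W : Submodule Rᵐᵒᵖ M) [Countable W] :
    ∃ W' : Submodule Rᵐᵒᵖ M, W ≤ W' ∧ Countable W' ∧
      ∀ (p n : ℕ) (a : Fin p → Fin n → R) (b : Fin n → W),
        (∃ y : Fin p → M, ∀ i, ∑ j, MulOpposite.op (a j i) • y j = b i) →
        ∃ y : Fin p → W', ∀ i, ∑ j, MulOpposite.op (a j i) • (y j : M) = b i := by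
  classical
  let T := Σ p n : ℕ, (Fin p → Fin n → R) × (Fin n → W)
  let solves : ∀ t : T, (Fin t.1 → M) → Prop := fun t y =>
    ∀ i, ∑ j, MulOpposite.op (t.2.2.1 j i) • y j = t.2.2.2 i
  -- The default 0 for unsolvable systems is harmless: only solvable ones are used.
  let sol : ∀ t : T, Fin t.1 → M := fun t => if h : ∃ y, solves t y then h.choose else 0
  have : Countable (Σ t : T, Fin t.1) := inferInstance
  have : Countable Rᵐᵒᵖ := MulOpposite.opEquiv.symm.injective.countable
  let v : W ⊕ (Σ t : T, Fin t.1) → M := Sum.elim (fun w => w) fun q => sol q.1 q.2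
  refine ⟨Submodule.span Rᵐᵒᵖ (Set.range v), fun w hw => Submodule.subset_span ⟨Sum.inl ⟨w, hw⟩, rfl⟩,
    inferInstance, fun p n a b h => ?_⟩
  let t : T := ⟨p, n, a, b⟩
  have ht : ∃ y, solves t y := h
  refine ⟨fun j => ⟨sol t j, Submodule.subset_span ⟨Sum.inr ⟨t, j⟩, rfl⟩⟩, fun i => ?_⟩
  have hs : sol t = ht.choose := dif_pos ht
  have := ht.choose_spec i
  rw [← hs] at this
  exact this

/-- Over a countable ring every element lies in a countable pure submodule. -/
theorem exists_countable_isEquationallyPure [Countable R] (x : M) :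
    ∃ W : Submodule Rᵐᵒᵖ M, x ∈ W ∧ Countable W ∧ IsEquationallyPure W := by
  have : Countable Rᵐᵒᵖ := MulOpposite.opEquiv.symm.injective.countable
  choose next hle hcount hsol using fun W : {W : Submodule Rᵐᵒᵖ M // Countable W} =>
    have := W.2
    exists_countable_solutions W.1
  have h0 : Countable (Submodule.span Rᵐᵒᵖ (Set.range fun _ : Unit => x)) := inferInstance
  -- Each finite system over the union has its right-hand sides in one stage and is solved in the
  -- next.
  let W : ℕ → {W : Submodule Rᵐᵒᵖ M // Countable W} := fun k =>
    Nat.rec ⟨_, h0⟩ (fun _ W => ⟨next W, hcount W⟩) k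
  have hmono : Monotone fun k => (W k).1 := monotone_nat_of_le_succ fun k => hle (W k)
  have hdir : Directed (· ≤ ·) fun k => (W k).1 := hmono.directed_le
  have hmem : ∀ {m : M}, m ∈ ⨆ k, (W k).1 ↔ ∃ k, m ∈ (W k).1 :=
    Submodule.mem_iSup_of_directed _ hdir
  refine ⟨⨆ k, (W k).1, hmem.2 ⟨0, Submodule.subset_span ⟨(), rfl⟩⟩, ?_, fun p n a b h => ?_⟩
  · have : ((⨆ k, (W k).1 : Submodule Rᵐᵒᵖ M) : Set M).Countable := by
      rw [Submodule.coe_iSup_of_directed _ hdir]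
      exact Set.countable_iUnion fun k => (W k).2
    exact this
  · choose k hk using fun i => hmem.1 (b i).2
    let K := Finset.univ.sup k
    have hK : ∀ i, (b i : M) ∈ (W K).1 := fun i => hmono (Finset.le_sup (Finset.mem_univ i)) (hk i)
    obtain ⟨y, hy⟩ := hsol (W K) p n a (fun i => ⟨b i, hK i⟩) h
    refine ⟨fun j => ⟨y j, hmem.2 ⟨K + 1, (y j).2⟩⟩, fun i => Subtype.ext ?_⟩
    simpa using hy i

end CountablePure

/-! ### Countable flat modules as sequential limits of free modules. -/

section CountableFlat

variable {R : Type u} [Ring R] {F : Type u} [AddCommGroup F] [Module Rᵐᵒᵖ F] {Y : Type u}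

/-- An element of the kernel of a homomorphism from a free module onto a flat module is killed by
an endomorphism over the flat module. -/
theorem IsFlat.exists_kill (hF : IsFlat R F) {π : (Y →₀ Rᵐᵒᵖ) →ₗ[Rᵐᵒᵖ] F}
    (hπ : Function.Surjective π) {k : Y →₀ Rᵐᵒᵖ} (hk : π k = 0) :
    ∃ f : (Y →₀ Rᵐᵒᵖ) →ₗ[Rᵐᵒᵖ] (Y →₀ Rᵐᵒᵖ), π ∘ₗ f = π ∧ f k = 0 := by
  classical
  -- The equational criterion: the relation π(k) = 0 says that `z` dies under `φ`, so by flatness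
  -- `z` comes from F ⊗ ker φ.
  let φ : (Y →₀ R) →ₗ[R] R := Finsupp.linearCombination R fun i => (k i).unop
  let z : BalancedTensor R F (Y →₀ R) :=
    ∑ i ∈ k.support, tmul R (π (Finsupp.single i 1)) (Finsupp.single i 1)
  have hz : BalancedTensor.map R F φ z = 0 := by
    have : BalancedTensor.map R F φ z = tmul R (π k) (1 : R) := by
      conv_rhs => rw [← Finsupp.sum_single k, Finsupp.sum, map_sum, sum_tmul]
      rw [map_sum]
      refine Finset.sum_congr rfl fun i _ => ?_
      have h1 : (Finsupp.single i (k i) : Y →₀ Rᵐᵒᵖ) =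
        MulOpposite.op (k i).unop • Finsupp.single i 1 := by simp
      rw [h1, map_smul, smul_tmul]
      simp [φ]
    rw [this, hk, zero_tmul]
  have hz' : BalancedTensor.map R F φ.rangeRestrict z = 0 := by
    refine (injective_iff_map_eq_zero _).1 (hF _ _ _ (LinearMap.range φ).injective_subtype) _ ?_
    rw [map_map]
    exact hz
  obtain ⟨w, hw⟩ := exists_map_eq (N := LinearMap.ker φ) (f := (LinearMap.ker φ).subtype)
    φ.surjective_rangeRestrict (fun n hn => ⟨⟨n, congrArg Subtype.val hn⟩, rfl⟩) hz'
  obtain ⟨p, y, h, rfl⟩ := exists_eq_sum w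
  choose y' hy' using fun j => hπ (y j)
  have hc : ∀ i ∈ k.support, ∑ j, MulOpposite.op ((h j : Y →₀ R) i) • y j =
      π (Finsupp.single i 1) := fun i hi => by
    have := DFunLike.congr_fun (congrArg (coordRight R F Y) hw) i
    simpa [Finsupp.finsetSum_apply, z, Finsupp.single_apply, apply_ite MulOpposite.op, ite_smul,
      Finset.sum_ite_eq, hi, Finsupp.mem_support_iff.1 hi] using this
  -- Each basis vector in the support of `k` is replaced by another lift of its image, a combination
  -- whose coefficients annihilate `k`; the others are left alone.
  let v : Y → (Y →₀ Rᵐᵒᵖ) := fun i =>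
    if i ∈ k.support then ∑ j, MulOpposite.op ((h j : Y →₀ R) i) • y' j else Finsupp.single i 1
  refine ⟨Finsupp.linearCombination Rᵐᵒᵖ v, ?_, ?_⟩
  · refine Finsupp.lhom_ext' fun i => LinearMap.ext_ring ?_
    simp only [LinearMap.comp_apply, Finsupp.lsingle_apply, Finsupp.linearCombination_single,
      one_smul, v]
    split_ifs with hi
    · simp only [map_sum, map_smul, hy', hc i hi]
    · rfl
  · have hker : ∀ j, ∑ i ∈ k.support, (h j : Y →₀ R) i * (k i).unop = 0 := fun j => by
      have h0 : φ (h j) = 0 := (h j).2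
      rw [Finsupp.linearCombination_apply, Finsupp.sum] at h0
      simp only [smul_eq_mul] at h0
      rw [← h0]
      have h1 : ∑ i ∈ k.support, (h j : Y →₀ R) i * (k i).unop =
          ∑ i ∈ k.support ∪ (h j : Y →₀ R).support, (h j : Y →₀ R) i * (k i).unop :=
        Finset.sum_subset Finset.subset_union_left fun i _ hi => by
          simp [Finsupp.notMem_support_iff.1 hi]
      rw [h1]
      exact (Finset.sum_subset Finset.subset_union_right fun i _ hi => by
          simp [Finsupp.notMem_support_iff.1 hi]).symm
    rw [Finsupp.linearCombination_apply, Finsupp.sum]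
    have h1 : ∀ i ∈ k.support, k i • v i =
        ∑ j, MulOpposite.op ((h j : Y →₀ R) i * (k i).unop) • y' j := fun i hi => by
      simp only [v, if_pos hi, Finset.smul_sum, smul_smul]
      rfl
    rw [Finset.sum_congr rfl h1, Finset.sum_comm]
    refine Finset.sum_eq_zero fun j _ => ?_
    rw [← Finset.sum_smul, ← Finset.op_sum, hker, MulOpposite.op_zero, zero_smul]

theorem IsFlat.exists_kill_finset (hF : IsFlat R F) {π : (Y →₀ Rᵐᵒᵖ) →ₗ[Rᵐᵒᵖ] F}
    (hπ : Function.Surjective π) (s : Finset (Y →₀ Rᵐᵒᵖ)) :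
    ∃ f : (Y →₀ Rᵐᵒᵖ) →ₗ[Rᵐᵒᵖ] (Y →₀ Rᵐᵒᵖ), π ∘ₗ f = π ∧ ∀ k ∈ s, π k = 0 → f k = 0 := by
  classical
  induction s using Finset.induction_on with
  | empty => exact ⟨LinearMap.id, rfl, by simp⟩
  | insert a s _ ih =>
    obtain ⟨f, hf, hfs⟩ := ih
    by_cases ha : π a = 0
    · obtain ⟨g, hg, hga⟩ := hF.exists_kill hπ (k := f a)
        (by rw [← LinearMap.comp_apply, hf, ha])
      refine ⟨g ∘ₗ f, by rw [← LinearMap.comp_assoc, hg, hf], fun k hk hk0 => ?_⟩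
      rcases Finset.mem_insert.1 hk with rfl | hk
      · exact hga
      · rw [LinearMap.comp_apply, hfs k hk hk0, map_zero]
    · refine ⟨f, hf, fun k hk hk0 => ?_⟩
      rcases Finset.mem_insert.1 hk with rfl | hk
      · exact absurd hk0 ha
      · exact hfs k hk hk0

/-- If finite subsets of the kernel of a homomorphism from a countable module are killed by
endomorphisms over its range, then the range is the direct limit of a sequence of endomorphisms. -/
theorem exists_exact_chainMap {S E F : Type*} [Ring S] [AddCommGroup E] [Module S E]
    [AddCommGroup F] [Module S F] [Countable E] {π : E →ₗ[S] F} (hπ : Function.Surjective π)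
    (h : ∀ s : Finset E, ∃ f : E →ₗ[S] E, π ∘ₗ f = π ∧ ∀ k ∈ s, π k = 0 → f k = 0) :
    ∃ (f : ℕ → E →ₗ[S] E) (q : (ℕ →₀ E) →ₗ[S] F),
      Function.Surjective q ∧ Function.Exact (chainMap f) q := by
  classical
  obtain ⟨e, he⟩ := exists_surjective_nat E
  choose kill hkill hkill0 using h
  let next : ℕ → (ℕ → E →ₗ[S] E) → E →ₗ[S] E :=
    fun n g => kill ((Finset.range (n + 1) ×ˢ Finset.range (n + 1)).image fun p => g p.1 (e p.2))
  -- `G n m` is the composite f (n - 1) ∘ ⋯ ∘ f m, and the identity for m ≥ n. It is built together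
  -- with `f`, because `f n` must kill the images at stage n of the kernel elements met so far.
  let G : ℕ → ℕ → E →ₗ[S] E := fun n =>
    Nat.rec (fun _ => LinearMap.id)
      (fun n g m => if m ≤ n then next n g ∘ₗ g m else LinearMap.id) n
  let f : ℕ → E →ₗ[S] E := fun n => next n (G n)
  have hGsucc : ∀ n m, m ≤ n → G (n + 1) m = f n ∘ₗ G n m := fun n m h => if_pos h
  have hGself : ∀ n, G n n = LinearMap.id := fun n => by
    cases n with
    | zero => rfl
    | succ n => exact if_neg (by lia)
  have hf : ∀ n, π ∘ₗ f n = π := fun n => hkill _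
  have hπG : ∀ m n, m ≤ n → π ∘ₗ G n m = π := fun m n h => by
    induction n, h using Nat.le_induction with
    | base => rw [hGself]; rfl
    | succ n hn ih => rw [hGsucc n m hn, ← LinearMap.comp_assoc, hf, ih]
  have hG0 : ∀ n m i, m ≤ n → i ≤ n → π (e i) = 0 → G (n + 1) m (e i) = 0 := by
    intro n m i hm hi h0
    rw [hGsucc n m hm]
    refine hkill0 _ _ (Finset.mem_image.2 ⟨(m, i), ?_, rfl⟩) ?_
    · simp only [Finset.mem_product, Finset.mem_range]
      lia
    · rw [← LinearMap.comp_apply, hπG m n hm, h0]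
  have hchain : ∀ m n, m ≤ n → ∀ x,
      Finsupp.single m x - Finsupp.single n (G n m x) ∈ LinearMap.range (chainMap f) := by
    intro m n h x
    induction n, h using Nat.le_induction with
    | base => rw [hGself, LinearMap.id_apply, sub_self]; exact zero_mem _
    | succ n hn ih =>
      have h1 := add_mem ih (LinearMap.mem_range_self (chainMap f) (Finsupp.single n (G n m x)))
      rwa [chainMap_single, sub_add_sub_cancel, ← LinearMap.comp_apply, ← hGsucc n m hn] at h1
  let q : (ℕ →₀ E) →ₗ[S] F := Finsupp.lsum ℕ fun _ => π
  have hq : ∀ n x, q (Finsupp.single n x) = π x := fun n x => by simp [q]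
  have hqf : q ∘ₗ chainMap f = 0 := Finsupp.lhom_ext' fun n => LinearMap.ext fun x => by
    rw [LinearMap.comp_apply, LinearMap.comp_apply, Finsupp.lsingle_apply, chainMap_single,
      map_sub, hq, hq, ← LinearMap.comp_apply, hf]
    simp
  refine ⟨f, q, fun x => ?_, fun w => ⟨fun hw => ?_, ?_⟩⟩
  · obtain ⟨y, rfl⟩ := hπ x
    exact ⟨Finsupp.single 0 y, hq 0 y⟩
  · have hstage : ∀ w : ℕ →₀ E, ∃ N, ∀ n ≥ N, ∃ x,
        w - Finsupp.single n x ∈ LinearMap.range (chainMap f) := by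
      intro w
      induction w using Finsupp.induction_linear with
      | zero => exact ⟨0, fun n _ => ⟨0, by simp⟩⟩
      | add u v hu hv =>
        obtain ⟨N, hN⟩ := hu
        obtain ⟨N', hN'⟩ := hv
        refine ⟨max N N', fun n hn => ?_⟩
        obtain ⟨x, hx⟩ := hN n ((le_max_left _ _).trans hn)
        obtain ⟨y, hy⟩ := hN' n ((le_max_right _ _).trans hn)
        refine ⟨x + y, ?_⟩
        have := add_mem hx hy
        rwa [sub_add_sub_comm, ← Finsupp.single_add] at this
      | single m x => exact ⟨m, fun n hn => ⟨_, hchain m n hn x⟩⟩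
    obtain ⟨N, hN⟩ := hstage w
    obtain ⟨x, hx⟩ := hN N le_rfl
    have hx0 : π x = 0 := by
      obtain ⟨c, hc⟩ := hx
      have h1 := congrArg q hc
      rw [← LinearMap.comp_apply, hqf, map_sub, hw, hq] at h1
      simpa using h1.symm
    obtain ⟨i, rfl⟩ := he x
    -- By stage max N i both the index of the kernel element and its starting stage have been
    -- treated, so it is killed one stage later.
    have h1 := hchain N (max N i + 1) (by lia) (e i)
    rw [hG0 _ N i (le_max_left _ _) (le_max_right _ _) hx0, Finsupp.single_zero, sub_zero] at h1
    have h2 := add_mem hx h1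
    rwa [sub_add_cancel] at h2
  · rintro ⟨c, rfl⟩
    exact LinearMap.congr_fun hqf c

theorem IsFlat.leftExtOrthogonal_of_countable [Countable R] (hF : IsFlat R F) [Countable F] :
    leftExtOrthogonal (rightExtOrthogonal (flatMittagLefflerModules R))
      (ModuleCat.of Rᵐᵒᵖ F) := by
  have : Countable Rᵐᵒᵖ := MulOpposite.opEquiv.symm.injective.countable
  obtain ⟨f, q, hq, hfq⟩ := exists_exact_chainMap (linearCombination_id_surjective Rᵐᵒᵖ F)
    (hF.exists_kill_finset (linearCombination_id_surjective Rᵐᵒᵖ F))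
  exact leftExtOrthogonal_coker_chainMap f hq hfq

end CountableFlat

/-! ### Arbitrary flat modules over a countable ring. -/

section CountableRing

variable {R : Type u} [Ring R]

/-- Over a countable ring, a submodule with flat quotient and an element are contained in a
submodule with flat quotient such that the factor is countable and flat. -/
theorem exists_countable_flat_step [Countable R] {P : Type u} [AddCommGroup P] [Module Rᵐᵒᵖ P]
    {D : Submodule Rᵐᵒᵖ P} (hD : IsFlat R (P ⧸ D)) (x : P) :
    ∃ (D' : Submodule Rᵐᵒᵖ P) (h : D ≤ D') (W : Submodule Rᵐᵒᵖ (P ⧸ D)) (p : D' →ₗ[Rᵐᵒᵖ] W),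
      x ∈ D' ∧ IsFlat R (P ⧸ D') ∧ Countable W ∧ IsFlat R W ∧ Function.Surjective p ∧
      Function.Exact (Submodule.inclusion h) p := by
  obtain ⟨W, hxW, hWc, hW⟩ := exists_countable_isEquationallyPure (R := R) (D.mkQ x)
  have hpure := fun (N : Type u) [AddCommGroup N] [Module R N] => hW.mapLeft_injective N
  -- The quotient by the preimage is (P/D)/W, flat because W is pure in the flat module P/D.
  let D' : Submodule Rᵐᵒᵖ P := W.comap D.mkQ
  have hle : D ≤ D' := fun d hd => by
    rw [Submodule.mem_comap, Submodule.mkQ_apply, (Submodule.Quotient.mk_eq_zero _).2 hd]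
    exact zero_mem _
  let p : D' →ₗ[Rᵐᵒᵖ] W := (D.mkQ ∘ₗ D'.subtype).codRestrict W fun d => d.2
  have hker : LinearMap.ker (W.mkQ ∘ₗ D.mkQ) = D' := by
    rw [LinearMap.ker_comp, Submodule.ker_mkQ]
  have e : (P ⧸ D') ≃ₗ[Rᵐᵒᵖ] ((P ⧸ D) ⧸ W) :=
    (Submodule.quotEquivOfEq _ _ hker.symm).trans
      ((W.mkQ ∘ₗ D.mkQ).quotKerEquivOfSurjective
        (W.mkQ_surjective.comp D.mkQ_surjective))
  refine ⟨D', hle, W, p, hxW, IsFlat.of_linearEquiv e (hD.quotient W hpure), hWc,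
    hD.of_injective_pure hpure, fun w => ?_, fun d => ⟨fun hd => ?_, ?_⟩⟩
  · obtain ⟨d, hd⟩ := D.mkQ_surjective w
    exact ⟨⟨d, by rw [Submodule.mem_comap, hd]; exact w.2⟩, Subtype.ext hd⟩
  · exact ⟨⟨d, (Submodule.Quotient.mk_eq_zero _).1 (congrArg Subtype.val hd)⟩, rfl⟩
  · rintro ⟨c, rfl⟩
    exact Subtype.ext ((Submodule.Quotient.mk_eq_zero _).2 c.2)

/-- Homomorphisms to the `Ext`-orthogonal of the flat Mittag-Leffler modules extend from a
submodule with flat quotient to a larger one containing a given element. -/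
theorem exists_extension_step [Countable R] {P : Type u} [AddCommGroup P] [Module Rᵐᵒᵖ P]
    {D : Submodule Rᵐᵒᵖ P} (hD : IsFlat R (P ⧸ D)) {C : ModuleCat.{u} Rᵐᵒᵖ}
    (hC : rightExtOrthogonal (flatMittagLefflerModules R) C) (g : D →ₗ[Rᵐᵒᵖ] C) (x : P) :
    ∃ (D' : Submodule Rᵐᵒᵖ P) (h : D ≤ D') (g' : D' →ₗ[Rᵐᵒᵖ] C),
      x ∈ D' ∧ IsFlat R (P ⧸ D') ∧ g' ∘ₗ Submodule.inclusion h = g := by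
  obtain ⟨D', hle, W, q, hx, hD', hWc, hWF, hq, hexact⟩ := exists_countable_flat_step hD x
  obtain ⟨g', hg'⟩ := exists_extension_of_subsingleton_ext (C := C)
    (Submodule.inclusion_injective hle) hq hexact (hWF.leftExtOrthogonal_of_countable C hC) g
  exact ⟨D', hle, g', hx, hD', hg'⟩

/-- Over a countable ring every flat module is in the double `Ext`-orthogonal of the flat
Mittag-Leffler modules. -/
theorem IsFlat.leftExtOrthogonal [Countable R] {M : Type u} [AddCommGroup M] [Module Rᵐᵒᵖ M]
    (hM : IsFlat R M) : leftExtOrthogonal (rightExtOrthogonal (flatMittagLefflerModules R))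
      (ModuleCat.of Rᵐᵒᵖ M) := by
  intro C hC
  let P := M →₀ Rᵐᵒᵖ
  let p : P →ₗ[Rᵐᵒᵖ] M := Finsupp.linearCombination Rᵐᵒᵖ id
  have hp : Function.Surjective p := linearCombination_id_surjective Rᵐᵒᵖ M
  refine subsingleton_ext_of_exists_extension (A := LinearMap.ker p) (C := C)
    (i := (LinearMap.ker p).subtype) (LinearMap.ker p).injective_subtype hp
    (exact_subtype_ker p) fun g => ?_
  let g₀ : P →ₗ.[Rᵐᵒᵖ] C := ⟨LinearMap.ker p, g⟩
  -- Only partial extensions whose domain has flat quotient are admitted: this survives unions of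
  -- chains and allows every further countable flat step.
  let Z : Set (P →ₗ.[Rᵐᵒᵖ] C) := {h | IsFlat R (P ⧸ h.domain)}
  have hg₀ : g₀ ∈ Z := IsFlat.of_linearEquiv (p.quotKerEquivOfSurjective hp) hM
  obtain ⟨m, hgm, hmZ, hmax⟩ := zorn_le_nonempty₀ Z (fun c hcZ hc y hy => by
    have hdir : DirectedOn (· ≤ ·) c := hc.directedOn
    refine ⟨LinearPMap.sSup c hdir, ?_, fun z hz => LinearPMap.le_sSup hdir hz⟩
    have : Nonempty c := ⟨⟨y, hy⟩⟩
    refine isFlat_quotient_of_directed (S := fun h : c => h.1.domain) ?_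
      (fun h => (LinearPMap.le_sSup hdir h.2).1) (fun x hx => ?_) fun h => hcZ h.2
    · intro h h'
      obtain ⟨k, hk, h1, h2⟩ := hdir h.1 h.2 h'.1 h'.2
      exact ⟨⟨k, hk⟩, h1.1, h2.1⟩
    · obtain ⟨h, hh, hx⟩ := (LinearPMap.mem_domain_sSup_iff ⟨y, hy⟩ hdir).1 hx
      exact ⟨⟨h, hh⟩, hx⟩) g₀ hg₀
  have htop : ∀ x, x ∈ m.domain := by
    intro x
    obtain ⟨D', hle, g', hx, hD', hg'⟩ := exists_extension_step hmZ hC m.toFun x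
    have hm' : m ≤ ⟨D', g'⟩ := ⟨hle, fun a b hab => by
      rw [show b = Submodule.inclusion hle a from Subtype.ext hab.symm]
      exact (LinearMap.congr_fun hg' a).symm⟩
    exact (hmax (y := ⟨D', g'⟩) hD' hm').1 hx
  refine ⟨m.toFun ∘ₗ LinearMap.codRestrict m.domain LinearMap.id htop, LinearMap.ext fun a => ?_⟩
  exact (hgm.2 (x := a) (y := ⟨a, htop a⟩) rfl).symm

end CountableRing

theorem mainTheorem11 (R : Type u) [Ring R] :
    (¬ IsRightPerfect R → ClosedUnderProducts (flatMittagLefflerModules R) →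
      ClosedUnderTransfiniteExtensions (flatMittagLefflerModules R) ∧
      ¬ ∃ C : RightModuleClass R, flatMittagLefflerModules R = leftExtOrthogonal C) ∧
    (Countable R → ClosedUnderProducts (flatMittagLefflerModules R) →
      leftExtOrthogonal (rightExtOrthogonal (flatMittagLefflerModules R)) = flatModules R) ∧
    (IsNoetherianRing R → ClosedUnderProducts (flatMittagLefflerModules R)) ∧
    (IsNoetherianRing R → ¬ IsArtinianRing R → ¬ IsRightPerfect R) := by
  refine ⟨fun hR _ => ⟨closedUnderTransfiniteExtensions_flatMittagLeffler,
    not_exists_eq_leftExtOrthogonal hR⟩, fun _ _ => ?_,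
    fun _ => closedUnderProducts_of_isNoetherianRing, fun _ hA hP => hA hP.isArtinianRing⟩
  funext M
  exact propext ⟨fun hM => isFlat_of_leftExtOrthogonal (M := M) hM,
    fun hM => IsFlat.leftExtOrthogonal (M := M) hM⟩
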